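/- An \emph{election} is a pair $E=(C,V)$ of a finite set $C$ of candidates and a finite collection $V$ of voters, each given by a preference list, i.e. a strict linear order on $C$; when candidates are removed, each voter's list is restricted to the remaining ones. For $c\ne d$ in $C$ let $N_E(c,d)$ be the number of voters who prefer $c$ to $d$. In \emph{maximin}, the score of $c\in C$ is $\min_{d\in C\setminus\{c\}}N_E(c,d)$ (a sole candidate has score $+\infty$), and the winners are the candidates with the highest score; $p$ is a \emph{unique winner} if the set of winners is exactly $\{p\}$. In the \emph{constructive AC$_{\mathrm u}$+DC control problem} for maximin (control by adding an unlimited number of candidates combined with deleting candidates) we are given two disjoint finite sets of candidates $C$ and $A$, a finite list $V$ of voters with preference lists over $C\cup A$, a preferred candidate $p\in C$, and an integer $k_{\mathrm{DC}}\ge 0$. The question is whether there are sets $A'\subseteq A$ and $C'\subseteq C$ with $p\notin C'$ and $|C'|\le k_{\mathrm{DC}}$ such that $p$ is a unique winner of the maximin election $((C\setminus C')\cup A',V)$. Inputs are encoded as strings that list $p$, $k_{\mathrm{DC}}$, $C$, $A$ and every voter's preference list explicitly, with candidate names and $k_{\mathrm{DC}}$ written in binary. \textbf{Theorem.} Maximin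 is \emph{vulnerable} to constructive AC$_{\mathrm u}$+DC control, that is: (i) (susceptibility) there are an input $(C,A,V,p,k_{\mathrm{DC}})$ such that $p$ is not a unique winner of $(C,V)$, and sets $A'\subseteq A$ and $C'\subseteq C\setminus\{p\}$ with $|C'|\le k_{\mathrm{DC}}$, such that $p$ is a unique winner of $((C\setminus C')\cup A',V)$; and (ii) there is a deterministic Turing machine, running in time polynomial in the length of the input string, that, given the string encoding any input as above, decides whether the answer to the constructive AC$_{\mathrm u}$+DC control problem for maximin is "yes". -/

import Mathlib

/-! Elections. Candidates are named by natural numbers. -/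

/-- `v` is a preference list over the candidate set `C`: a listing of the members of `C`, each
exactly once, from the most preferred to the least preferred. -/
def IsPreferenceList (C : Finset ℕ) (v : List ℕ) : Prop :=
  v.Nodup ∧ v.toFinset = C

/-- An election `(C, V)`: a finite candidate set and a finite collection of voters, each of them
represented by a preference list over `C`. -/
structure Election where
  cands : Finset ℕ
  votes : List (List ℕ)
  isPref : ∀ v ∈ votes, IsPreferenceList cands v

namespace Election

/-- The election obtained by keeping only the candidates in `X`; every voter keeps his or her
relative ranking of the remaining candidates. -/
def restrict (E : Election) (X : Finset ℕ) : Election where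
  cands := E.cands ∩ X
  votes := E.votes.map fun v => v.filter fun c => c ∈ X
  isPref := by
    intro w hw
    obtain ⟨v, hv, rfl⟩ := List.mem_map.1 hw
    obtain ⟨h1, h2⟩ := E.isPref v hv
    refine ⟨h1.filter _, ?_⟩
    ext c
    simp [← h2]

/-- `N_E(a, b)`: the number of voters who prefer `a` to `b`. -/
def prefCount (E : Election) (a b : ℕ) : ℕ :=
  E.votes.countP fun v => v.idxOf a < v.idxOf b

/-- The maximin score `min_{d ∈ C - {c}} N_E(c, d)`. The minimum over the empty set (when `c` is
the only candidate) is `⊤`. -/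
noncomputable def maximinScore (E : Election) (c : ℕ) : ℕ∞ :=
  (E.cands.erase c).inf fun d => (E.prefCount c d : ℕ∞)

end Election

/-- An election system maps each election to a set of winners among its candidates. -/
structure ElectionSystem where
  winners : Election → Finset ℕ
  winners_subset : ∀ E, winners E ⊆ E.cands

/-- The maximin system: the winners are the candidates with the highest score. -/
noncomputable def maximin : ElectionSystem where
  winners E := E.cands.filter fun c => ∀ d ∈ E.cands, E.maximinScore d ≤ E.maximinScore c
  winners_subset _ := Finset.filter_subset _ _

/-- `p` is a unique winner: the winner set is exactly `{p}`. -/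
def ElectionSystem.IsUniqueWinner (S : ElectionSystem) (E : Election) (p : ℕ) : Prop :=
  S.winners E = {p}

/-- An input of the AC_u+DC problem: the list `C` of candidates, the list `A` of spoiler
candidates (disjoint from `C`), the list `V` of voters, with preference lists over `C ∪ A`, the
distinguished candidate `p ∈ C`, and the bound `kDC` on the number of deleted candidates. -/
structure ACuDCInput where
  C : List ℕ
  A : List ℕ
  V : List (List ℕ)
  p : ℕ
  kDC : ℕ
  nodup : (C ++ A).Nodup
  isPref : ∀ v ∈ V, IsPreferenceList (C ++ A).toFinset v
  p_mem : p ∈ C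

namespace ACuDCInput

/-- The election `(C ∪ A, V)`. -/
def fullElection (I : ACuDCInput) : Election where
  cands := (I.C ++ I.A).toFinset
  votes := I.V
  isPref := I.isPref

/-- The original election `(C, V)`. -/
def originalElection (I : ACuDCInput) : Election :=
  I.fullElection.restrict I.C.toFinset

/-- The election `((C - C') ∪ A', V)` after deleting `C'` and adding `A'`. -/
def controlledElection (I : ACuDCInput) (A' C' : Finset ℕ) : Election :=
  I.fullElection.restrict ((I.C.toFinset \ C') ∪ A')

end ACuDCInput

namespace ElectionSystem

/-- The question of the constructive AC_u+DC control problem (unique-winner model): can `p` be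
made a unique winner by adding any number of spoiler candidates and deleting at most `kDC`
candidates other than `p`? -/
def ConstructiveACuDC (S : ElectionSystem) (I : ACuDCInput) : Prop :=
  ∃ A' C' : Finset ℕ, A' ⊆ I.A.toFinset ∧ C' ⊆ I.C.toFinset ∧ I.p ∉ C' ∧ C'.card ≤ I.kDC ∧
    S.IsUniqueWinner (I.controlledElection A' C') I.p

/-- There is a scenario in which the control action makes someone become a unique winner. -/
def SusceptibleConstructiveACuDC (S : ElectionSystem) : Prop :=
  ∃ I : ACuDCInput, ¬ S.IsUniqueWinner I.originalElection I.p ∧ S.ConstructiveACuDC I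

end ElectionSystem

/-! Encoding of the inputs as strings over the finite alphabet `Γ'`; all numbers are in binary. -/

namespace ACuDCInput

open Computability

/-- A number in binary, terminated by a comma. -/
def encodeNumber (n : ℕ) : List Γ' :=
  (encodeNat n).map Γ'.bit ++ [Γ'.comma]

/-- A list of numbers, enclosed in brackets. -/
def encodeNumbers (l : List ℕ) : List Γ' :=
  Γ'.bra :: (l.flatMap encodeNumber ++ [Γ'.ket])

/-- The input string: `p`, `kDC`, `C`, `A`, and then one preference list for each voter. -/
def encodeString (I : ACuDCInput) : List Γ' :=
  encodeNumber I.p ++ (encodeNumber I.kDC ++ (encodeNumbers I.C ++ (encodeNumbers I.A ++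
    I.V.flatMap encodeNumbers)))

theorem bits_append_inj : ∀ {a b : List Bool} {r s : List Γ'},
    a.map Γ'.bit ++ Γ'.comma :: r = b.map Γ'.bit ++ Γ'.comma :: s → a = b ∧ r = s
  | [], [], _, _, h => by simpa using h
  | [], _ :: _, _, _, h => by simp at h
  | _ :: _, [], _, _, h => by simp at h
  | x :: a, y :: b, r, s, h => by
    simp only [List.map_cons, List.cons_append, List.cons.injEq, Γ'.bit.injEq] at h
    obtain ⟨h1, h2⟩ := bits_append_inj h.2
    exact ⟨by rw [h.1, h1], h2⟩

theorem encodeNumber_append_inj {m n : ℕ} {r s : List Γ'}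
    (h : encodeNumber m ++ r = encodeNumber n ++ s) : m = n ∧ r = s := by
  simp only [encodeNumber, List.append_assoc, List.singleton_append] at h
  obtain ⟨h1, h2⟩ := bits_append_inj h
  refine ⟨?_, h2⟩
  rw [← decode_encodeNat m, h1, decode_encodeNat]

theorem encodeNumber_append_ne_ket (m : ℕ) (r s : List Γ') :
    encodeNumber m ++ r ≠ Γ'.ket :: s := by
  unfold encodeNumber
  cases encodeNat m <;> simp

theorem numbers_append_inj : ∀ {k l : List ℕ} {r s : List Γ'},
    k.flatMap encodeNumber ++ Γ'.ket :: r = l.flatMap encodeNumber ++ Γ'.ket :: s → k = l ∧ r = s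
  | [], [], _, _, h => by simpa using h
  | [], y :: l, r, s, h => by
    simp only [List.flatMap_cons, List.append_assoc] at h
    exact absurd h.symm (encodeNumber_append_ne_ket _ _ _)
  | x :: k, [], r, s, h => by
    simp only [List.flatMap_cons, List.append_assoc] at h
    exact absurd h (encodeNumber_append_ne_ket _ _ _)
  | x :: k, y :: l, r, s, h => by
    simp only [List.flatMap_cons, List.append_assoc] at h
    obtain ⟨h1, h2⟩ := encodeNumber_append_inj h
    obtain ⟨h3, h4⟩ := numbers_append_inj h2
    exact ⟨by rw [h1, h3], h4⟩

theorem encodeNumbers_append_inj {k l : List ℕ} {r s : List Γ'}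
    (h : encodeNumbers k ++ r = encodeNumbers l ++ s) : k = l ∧ r = s := by
  simp only [encodeNumbers, List.cons_append, List.append_assoc, List.nil_append,
    List.cons.injEq, true_and] at h
  exact numbers_append_inj h

theorem votes_inj : ∀ {v w : List (List ℕ)},
    v.flatMap encodeNumbers = w.flatMap encodeNumbers → v = w
  | [], [], _ => rfl
  | [], _ :: _, h => by simp [encodeNumbers] at h
  | _ :: _, [], h => by simp [encodeNumbers] at h
  | x :: v, y :: w, h => by
    simp only [List.flatMap_cons] at h
    obtain ⟨h1, h2⟩ := encodeNumbers_append_inj h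
    rw [h1, votes_inj h2]

theorem encodeString_injective : Function.Injective encodeString := by
  intro I J h
  unfold encodeString at h
  obtain ⟨hp, h⟩ := encodeNumber_append_inj h
  obtain ⟨hk, h⟩ := encodeNumber_append_inj h
  obtain ⟨hC, h⟩ := encodeNumbers_append_inj h
  obtain ⟨hA, h⟩ := encodeNumbers_append_inj h
  have hV := votes_inj h
  cases I
  cases J
  simp_all

open Classical in
/-- The encoding of inputs as strings. -/
noncomputable def encoding : Encoding ACuDCInput Γ' where
  encode := encodeString
  decode w := if h : ∃ I, encodeString I = w then some h.choose else none
  decode_encode I := by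
    have h : ∃ J, encodeString J = encodeString I := ⟨I, rfl⟩
    rw [dif_pos h]
    exact congrArg some (encodeString_injective h.choose_spec)

end ACuDCInput

/-- Some deterministic polynomial-time Turing machine answers the question `Q` on every input;
the running time is bounded by a polynomial in the length of the input string. -/
def DecidableInPolyTime (Q : ACuDCInput → Prop) : Prop :=
  ∃ f : ACuDCInput → Bool, (∀ I, f I = true ↔ Q I) ∧
    Nonempty (Turing.TM2ComputableInPolyTime ACuDCInput.encoding.encode
      Computability.encodingBoolBool.encode f)

/-- Vulnerability to constructive AC_u+DC control: the system is susceptible to it, and a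
deterministic polynomial-time algorithm decides the control problem. -/
def ElectionSystem.VulnerableConstructiveACuDC (S : ElectionSystem) : Prop :=
  S.SusceptibleConstructiveACuDC ∧ DecidableInPolyTime S.ConstructiveACuDC

/-! Only the final candidate set `R` matters. Adding is free, so `A'` is `R ∩ A`, and the cost is
the number of members of `C` missing from `R`. `p` wins alone in `R` exactly when some threshold
`k`, the support of `p` against some candidate `c`, is reached by `p` against everyone in `R` and
missed by every other member of `R` against someone in `R` (`isUniqueWinner_restrict_iff`).

For fixed `k` this property (`Attains`) is preserved by unions, so there is a largest such `R`,
which also needs the fewest deletions. It is found greedily: keep `p` and the candidates against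
which `p` reaches `k`, then repeatedly discard every candidate other than `p` that reaches `k`
against all remaining ones. No discarded candidate can lie in any good set (`subset_remaining`), and
after as many rounds as there are candidates the process is stationary (`iterate_prune_fixed`),
hence the result is good (`attains_remaining`). There are at most as many thresholds as candidates;
trying all of them decides the problem (`answer_iff`).

For the Turing machine, structured programs over Boolean stacks are compiled to `TM2` machines with
the same time bound (`Runs.reachesIn`). Data are binary trees in prefix code, and `PolyTime` is
shown to be closed under composition, pairing, case distinction, bounded iteration and list folds
(`PolyTime.iterate`, `PolyTime.foldl`). The algorithm is written with these operations, so its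
running time follows by combining closure lemmas. Thresholds are handled as lists of supporters,
compared by length, which avoids arithmetic on counts. `PolyTime.nonempty_tm2` turns the resulting
program into a machine that works on the input string. -/

open Computability Turing Function

/-! # Structured programs over Boolean stacks and their compilation to Turing machines -/

/-- Structured programs operating on Boolean stacks indexed by `K`. -/
inductive StackProg (K : Type) : Type
  | push (k : K) (b : Bool) : StackProg K
  | pop (k : K) : StackProg K
  | seq (c d : StackProg K) : StackProg K
  | cond (k : K) (P : Option Bool → Bool) (c d : StackProg K) : StackProg K
  | loop (k : K) (P : Option Bool → Bool) (c : StackProg K) : StackProg K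

namespace StackProg

variable {K : Type}

/-- `Runs c s t n`: started in the store `s`, the program `c` terminates in the store `t` after at
most `n` steps. -/
inductive Runs [DecidableEq K] :
    StackProg K → (K → List Bool) → (K → List Bool) → ℕ → Prop
  | push (k : K) (b : Bool) (s : K → List Bool) : Runs (push k b) s (update s k (b :: s k)) 1
  | pop (k : K) (s : K → List Bool) : Runs (pop k) s (update s k (s k).tail) 1
  | seq {c d s t u m n} : Runs c s t m → Runs d t u n → Runs (seq c d) s u (m + n)
  | cond_true {k P c d s t n} : P (s k).head? = true → Runs c s t n →
      Runs (cond k P c d) s t (n + 1)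
  | cond_false {k P c d s t n} : P (s k).head? = false → Runs d s t n →
      Runs (cond k P c d) s t (n + 1)
  | loop_done {k P c s} : P (s k).head? = false → Runs (loop k P c) s s 1
  | loop_step {k P c s t u m n} : P (s k).head? = true → Runs c s t m →
      Runs (loop k P c) t u n → Runs (loop k P c) s u (m + n + 1)
  | mono {c s t m n} : Runs c s t m → m ≤ n → Runs c s t n

/-! ### Compilation -/

/-- The labels of the compiled program. -/
def Label : StackProg K → Type
  | push _ _ => Unit
  | pop _ => Unit
  | seq c d => c.Label ⊕ d.Label
  | cond _ _ c d => Option (c.Label ⊕ d.Label)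
  | loop _ _ c => Option c.Label

/-- There are finitely many labels. -/
@[reducible]
def labelFintype : (c : StackProg K) → Fintype c.Label
  | push _ _ => inferInstanceAs (Fintype Unit)
  | pop _ => inferInstanceAs (Fintype Unit)
  | seq c d =>
    letI := c.labelFintype; letI := d.labelFintype
    inferInstanceAs (Fintype (c.Label ⊕ d.Label))
  | cond _ _ c d =>
    letI := c.labelFintype; letI := d.labelFintype
    inferInstanceAs (Fintype (Option (c.Label ⊕ d.Label)))
  | loop _ _ c =>
    letI := c.labelFintype
    inferInstanceAs (Fintype (Option c.Label))

/-- The label at which the compiled program starts. -/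
def entry : (c : StackProg K) → c.Label
  | push _ _ => ()
  | pop _ => ()
  | seq c _ => Sum.inl c.entry
  | cond _ _ _ _ => none
  | loop _ _ _ => none

/-- The compiled machine has one additional stack, which holds the input string. -/
abbrev Alphabet (K : Type) : Option K → Type
  | none => Γ'
  | some _ => Bool

/-- The stacks of the compiled machine. -/
def stackMap (w : List Γ') (s : K → List Bool) : ∀ k : Option K, List (Alphabet K k)
  | none => w
  | some k => s k

/-- The statement that branches on a test of the top of a Boolean stack. -/
def branchOn {Λ : Type} (k : K) (P : Option Bool → Bool) (yes no : Λ) :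
    TM2.Stmt (Alphabet K) Λ (Option Γ') :=
  .peek (some k) (fun _ o => o.map Γ'.bit) <| .branch (fun v => P (v.map sectionΓ'Bool))
    (.load (fun _ => none) (.goto fun _ => yes)) (.load (fun _ => none) (.goto fun _ => no))

/-- The compiled program, continuing at the label `out`. -/
def compile {Λ : Type} : (c : StackProg K) → (c.Label → Λ) → Λ → c.Label →
    TM2.Stmt (Alphabet K) Λ (Option Γ')
  | push k b, _, out, _ => .push (some k) (fun _ => b) (.goto fun _ => out)
  | pop k, _, out, _ => .pop (some k) (fun v _ => v) (.goto fun _ => out)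
  | seq c d, inj, out, l => Sum.rec
      (fun l => c.compile (fun x => inj (.inl x)) (inj (.inr d.entry)) l)
      (fun l => d.compile (fun x => inj (.inr x)) out l) l
  | cond k P c d, inj, out, l => Option.rec
      (branchOn k P (inj (some (.inl c.entry))) (inj (some (.inr d.entry))))
      (fun l => Sum.rec
        (fun l => c.compile (fun x => inj (some (.inl x))) out l)
        (fun l => d.compile (fun x => inj (some (.inr x))) out l) l) l
  | loop k P c, inj, out, l => Option.rec
      (branchOn k P (inj (some c.entry)) out)
      (fun l => c.compile (fun x => inj (some x)) (inj none) l) l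

/-- `ReachesIn f a b n`: iterating `f` leads from `a` to `b` in at most `n` steps. -/
def ReachesIn {σ : Type*} (f : σ → Option σ) (a b : σ) (n : ℕ) : Prop :=
  Nonempty (StateTransition.EvalsToInTime f a (some b) n)

theorem ReachesIn.single {σ : Type*} {f : σ → Option σ} {a b : σ} (h : f a = some b) :
    ReachesIn f a b 1 :=
  ⟨⟨⟨1, h⟩, le_rfl⟩⟩

theorem ReachesIn.trans {σ : Type*} {f : σ → Option σ} {a b c : σ} {m n : ℕ}
    (h₁ : ReachesIn f a b m) (h₂ : ReachesIn f b c n) : ReachesIn f a c (m + n) := by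
  obtain ⟨h₁⟩ := h₁
  obtain ⟨h₂⟩ := h₂
  rw [Nat.add_comm]
  exact ⟨.trans f m n a b _ h₁ h₂⟩

theorem ReachesIn.mono {σ : Type*} {f : σ → Option σ} {a b : σ} {m n : ℕ}
    (h : ReachesIn f a b m) (hmn : m ≤ n) : ReachesIn f a b n := by
  obtain ⟨h⟩ := h
  exact ⟨⟨h.toEvalsTo, h.steps_le_m.trans hmn⟩⟩

variable [DecidableEq K]

theorem update_stackMap (w : List Γ') (s : K → List Bool) (k : K) (v : List Bool) :
    update (stackMap w s) (some k) v = stackMap w (update s k v) := by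
  funext i
  rcases i with _ | i
  · rfl
  · by_cases h : i = k
    · subst h
      simp [stackMap]
    · simp [stackMap, h]

theorem step_branchOn {Λ : Type} {M : Λ → TM2.Stmt (Alphabet K) Λ (Option Γ')} {l : Λ} {k : K}
    {P : Option Bool → Bool} {yes no : Λ} (hl : M l = branchOn k P yes no) (w : List Γ')
    (s : K → List Bool) :
    TM2.step M ⟨some l, none, stackMap w s⟩ =
      some ⟨some (if P (s k).head? then yes else no), none, stackMap w s⟩ := by
  have h : Option.map sectionΓ'Bool (Option.map Γ'.bit (s k).head?) = (s k).head? := by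
    cases (s k).head? <;> rfl
  simp only [TM2.step, hl, branchOn, TM2.stepAux, stackMap, h]
  cases P (s k).head? <;> rfl

/-- Every push, pop and test is one machine step, and the internal state is `none` again at each
label, so time bounds carry over unchanged. The exit label must vary in the induction: the first
part of a sequence exits to the entry of the second, and a loop body exits to the loop's test. -/
theorem Runs.reachesIn {c : StackProg K} {s t : K → List Bool} {n : ℕ} (h : Runs c s t n)
    {Λ : Type} {M : Λ → TM2.Stmt (Alphabet K) Λ (Option Γ')} {inj : c.Label → Λ} {out : Λ}
    (hM : ∀ l, M (inj l) = c.compile inj out l) (w : List Γ') :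
    ReachesIn (TM2.step M) ⟨some (inj c.entry), none, stackMap w s⟩
      ⟨some out, none, stackMap w t⟩ n := by
  induction h generalizing out with
  | push k b s =>
    apply ReachesIn.single
    simp only [TM2.step, hM, compile, TM2.stepAux]
    rw [← update_stackMap]
    rfl
  | pop k s =>
    apply ReachesIn.single
    simp only [TM2.step, hM, compile, TM2.stepAux]
    rw [← update_stackMap]
    rfl
  | seq _ _ ihc ihd =>
    exact (ihc (inj := fun x => inj (.inl x)) fun l => hM (.inl l)).trans
      (ihd (inj := fun x => inj (.inr x)) fun l => hM (.inr l))
  | cond_true hP _ ih =>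
    have h := step_branchOn (hM none) w
    rw [Nat.add_comm]
    refine (ReachesIn.single (h _)).trans ?_
    rw [if_pos hP]
    exact ih (inj := fun x => inj (some (.inl x))) fun l => hM (some (.inl l))
  | cond_false hP _ ih =>
    have h := step_branchOn (hM none) w
    rw [Nat.add_comm]
    refine (ReachesIn.single (h _)).trans ?_
    rw [if_neg (by simp [hP])]
    exact ih (inj := fun x => inj (some (.inr x))) fun l => hM (some (.inr l))
  | @loop_done k P c s hP =>
    have h' := ReachesIn.single (step_branchOn (hM none) w s)
    rw [if_neg (by simp [hP])] at h'
    exact h'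
  | loop_step hP _ _ ihc ihl =>
    have h := step_branchOn (hM none) w
    rw [Nat.add_comm]
    refine (ReachesIn.single (h _)).trans ?_
    rw [if_pos hP]
    exact (ihc (inj := fun x => inj (some x)) fun l => hM (some l)).trans (ihl hM)
  | mono _ hmn ih => exact (ih hM).mono hmn

/-! ### Renaming of stacks -/

/-- Renaming the stacks of a program. -/
def map {K' : Type} (e : K → K') : StackProg K → StackProg K'
  | push k b => push (e k) b
  | pop k => pop (e k)
  | seq c d => seq (c.map e) (d.map e)
  | cond k P c d => cond (e k) P (c.map e) (d.map e)
  | loop k P c => loop (e k) P (c.map e)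

theorem extend_update {K' : Type} [DecidableEq K'] {e : K → K'} (he : Injective e)
    (s : K → List Bool) (r : K' → List Bool) (k : K) (v : List Bool) :
    extend e (update s k v) r = update (extend e s r) (e k) v := by
  funext i
  by_cases h : ∃ j, e j = i
  · obtain ⟨j, rfl⟩ := h
    by_cases hj : j = k
    · subst hj
      simp [he.extend_apply]
    · simp [he.extend_apply, hj, he.ne hj]
  · rw [extend_apply' _ _ _ h, update_of_ne, extend_apply' _ _ _ h]
    rintro rfl
    exact h ⟨k, rfl⟩

theorem Runs.map {K' : Type} [DecidableEq K'] {e : K → K'} (he : Injective e) {c : StackProg K}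
    {s t : K → List Bool} {n : ℕ} (h : Runs c s t n) (r : K' → List Bool) :
    Runs (c.map e) (extend e s r) (extend e t r) n := by
  induction h with
  | push k b s =>
    rw [extend_update he, ← he.extend_apply s r k]
    exact .push _ _ _
  | pop k s =>
    rw [extend_update he, ← he.extend_apply s r k]
    exact .pop _ _
  | seq _ _ ihc ihd => exact .seq ihc ihd
  | cond_true hP _ ih => exact .cond_true (by rwa [he.extend_apply]) ih
  | cond_false hP _ ih => exact .cond_false (by rwa [he.extend_apply]) ih
  | loop_done hP => exact .loop_done (by rwa [he.extend_apply])
  | loop_step hP _ _ ihc ihl => exact .loop_step (by rwa [he.extend_apply]) ihc ihl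
  | mono _ hmn ih => exact ih.mono hmn

theorem Runs.map_of_eq {K' : Type} [DecidableEq K'] {e : K → K'} (he : Injective e)
    {c : StackProg K} {s t : K → List Bool} {n : ℕ} (h : Runs c s t n) {s' t' : K' → List Bool}
    (hs : ∀ k, s' (e k) = s k) (ht : ∀ k, t' (e k) = t k)
    (hst : ∀ i, (¬ ∃ k, e k = i) → t' i = s' i) : Runs (c.map e) s' t' n := by
  have h' := h.map he s'
  have h₁ : extend e s s' = s' := by
    funext i
    by_cases hi : ∃ k, e k = i
    · obtain ⟨k, rfl⟩ := hi
      rw [he.extend_apply, hs]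
    · rw [extend_apply' _ _ _ hi]
  have h₂ : extend e t s' = t' := by
    funext i
    by_cases hi : ∃ k, e k = i
    · obtain ⟨k, rfl⟩ := hi
      rw [he.extend_apply, ht]
    · rw [extend_apply' _ _ _ hi, hst i hi]
  rwa [h₁, h₂] at h'

end StackProg

/-! # Polynomial-time functions on data represented by binary trees -/

/-- Binary trees. -/
inductive BinTree : Type
  | nil : BinTree
  | cons (a b : BinTree) : BinTree

/-- Prefix notation for binary trees. -/
def BinTree.code : BinTree → List Bool
  | nil => [false]
  | cons a b => true :: (a.code ++ b.code)

theorem BinTree.head?_code (x : BinTree) : x.code.head? = some true ↔ x ≠ .nil := by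
  cases x <;> simp [code]

/-- Types whose elements are represented by binary trees. -/
class TreeRep (α : Type) where
  /-- The tree that represents an element. -/
  tree : α → BinTree

namespace TreeRep

variable {α β : Type}

instance : TreeRep Bool := ⟨fun b => bif b then .cons .nil .nil else .nil⟩

instance [TreeRep α] [TreeRep β] : TreeRep (α × β) := ⟨fun x => .cons (tree x.1) (tree x.2)⟩

instance [TreeRep α] : TreeRep (List α) := ⟨List.foldr (fun a t => .cons (tree a) t) .nil⟩

instance [TreeRep α] {P : α → Prop} : TreeRep {a // P a} := ⟨fun a => tree a.1⟩

theorem tree_true : tree true = .cons .nil .nil := rfl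
theorem tree_false : tree false = .nil := rfl
theorem tree_pair [TreeRep α] [TreeRep β] (a : α) (b : β) : tree (a, b) = .cons (tree a) (tree b) :=
  rfl
theorem tree_nil [TreeRep α] : tree ([] : List α) = .nil := rfl
theorem tree_cons [TreeRep α] (a : α) (l : List α) : tree (a :: l) = .cons (tree a) (tree l) := rfl

/-- The string that represents an element. -/
def word [TreeRep α] (a : α) : List Bool := (tree a).code

/-- The length of the string that represents an element. -/
def size [TreeRep α] (a : α) : ℕ := (word a).length

theorem word_pair [TreeRep α] [TreeRep β] (a : α) (b : β) :
    word (a, b) = true :: (word a ++ word b) := rfl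

theorem size_pair [TreeRep α] [TreeRep β] (a : α) (b : β) :
    size (a, b) = size a + size b + 1 := by
  simp [size, word_pair]

theorem size_nil [TreeRep α] : size ([] : List α) = 1 := rfl

theorem size_cons [TreeRep α] (a : α) (l : List α) : size (a :: l) = size a + size l + 1 := by
  simp [size, word, tree_cons, BinTree.code]

theorem size_bool_le (b : Bool) : size b ≤ 3 := by
  cases b <;> decide

theorem one_le_size [TreeRep α] (a : α) : 1 ≤ size a := by
  unfold size word
  cases tree a <;> simp [BinTree.code]

theorem size_eq_of_tree_eq [TreeRep α] [TreeRep β] {a : α} {b : β} (h : tree a = tree b) :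
    size a = size b := by
  rw [size, word, h, size, word]

theorem word_eq_of_tree_eq [TreeRep α] [TreeRep β] {a : α} {b : β} (h : tree a = tree b) :
    word a = word b := by
  rw [word, h, word]

end TreeRep

namespace StackProg

theorem Runs.congr {K : Type} [DecidableEq K] {c : StackProg K} {s t t' : K → List Bool} {m n : ℕ}
    (h : Runs c s t m) (ht : t = t') (hmn : m ≤ n) : Runs c s t' n :=
  ht ▸ h.mono hmn

/-! ### Elementary stack programs: moving, clearing and writing. -/

section Basic

variable {K : Type}

/-- Moves the symbols of stack `a` to stack `b`, reversing their order. -/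
def move (a b : K) : StackProg K :=
  loop a Option.isSome (cond a (· == some true) (seq (pop a) (push b true))
    (seq (pop a) (push b false)))

/-- Moves the symbols of stack `a` to both of the stacks `b` and `d`. -/
def moveTwo (a b d : K) : StackProg K :=
  loop a Option.isSome (cond a (· == some true) (seq (pop a) (seq (push b true) (push d true)))
    (seq (pop a) (seq (push b false) (push d false))))

/-- Empties the stack `a`. -/
def clear (a : K) : StackProg K :=
  loop a Option.isSome (pop a)

/-- Replaces the contents of the stack `a`. -/
def write (a : K) : List Bool → StackProg K
  | [] => clear a
  | x :: w => seq (write a w) (push a x)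

variable [DecidableEq K]

theorem runs_move {a b : K} (hab : a ≠ b) (w : List Bool) (s : K → List Bool) (hs : s a = w) :
    Runs (move a b) s (update (update s a []) b (w.reverse ++ s b)) (4 * w.length + 1) := by
  induction w generalizing s with
  | nil =>
    refine (Runs.loop_done (by simp [hs])).congr ?_ (by simp)
    funext i
    by_cases hb : i = b
    · simp [hb]
    · by_cases ha : i = a <;> simp [ha, hb, hs, hab]
  | cons x w ih =>
    have key : Runs (cond a (· == some true) (seq (pop a) (push b true))
        (seq (pop a) (push b false))) s (update (update s a w) b (x :: s b)) 3 := by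
      have h : ∀ y, Runs (seq (pop a) (push b y)) s (update (update s a w) b (y :: s b)) 2 := by
        intro y
        refine ((Runs.pop a s).seq (Runs.push b y _)).congr ?_ le_rfl
        simp [hs, hab.symm]
      cases x
      · exact .cond_false (by simp [hs]) (h false)
      · exact .cond_true (by simp [hs]) (h true)
    refine (Runs.loop_step (by simp [hs]) key (ih _ (by simp [hab]))).congr ?_ ?_
    · funext i
      by_cases hb : i = b
      · simp [hb]
      · by_cases ha : i = a <;> simp [ha, hb, hab]
    · simp only [List.length_cons]
      omega

theorem runs_moveTwo {a b d : K} (hab : a ≠ b) (had : a ≠ d) (hbd : b ≠ d) (w : List Bool)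
    (s : K → List Bool) (hs : s a = w) :
    Runs (moveTwo a b d) s
      (update (update (update s a []) b (w.reverse ++ s b)) d (w.reverse ++ s d))
      (5 * w.length + 1) := by
  induction w generalizing s with
  | nil =>
    refine (Runs.loop_done (by simp [hs])).congr ?_ (by simp)
    funext i
    by_cases hd : i = d
    · simp [hd]
    · by_cases hb : i = b
      · simp [hb, hbd]
      · by_cases ha : i = a <;> simp [ha, hb, hd, hs, hab, had]
  | cons x w ih =>
    have key : Runs (cond a (· == some true) (seq (pop a) (seq (push b true) (push d true)))
        (seq (pop a) (seq (push b false) (push d false)))) s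
        (update (update (update s a w) b (x :: s b)) d (x :: s d)) 4 := by
      have h : ∀ y, Runs (seq (pop a) (seq (push b y) (push d y))) s
          (update (update (update s a w) b (y :: s b)) d (y :: s d)) 3 := by
        intro y
        refine ((Runs.pop a s).seq ((Runs.push b y _).seq (Runs.push d y _))).congr ?_ le_rfl
        simp [hs, hab.symm, had.symm, hbd.symm]
      cases x
      · exact .cond_false (by simp [hs]) (h false)
      · exact .cond_true (by simp [hs]) (h true)
    refine (Runs.loop_step (by simp [hs]) key (ih _ (by simp [hab, had]))).congr ?_ ?_
    · funext i
      by_cases hd : i = d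
      · simp [hd]
      · by_cases hb : i = b
        · simp [hb, hbd]
        · by_cases ha : i = a <;> simp [ha, hb, hd, hab, had]
    · simp only [List.length_cons]
      omega

theorem runs_clear {a : K} (w : List Bool) (s : K → List Bool) (hs : s a = w) :
    Runs (clear a) s (update s a []) (2 * w.length + 1) := by
  induction w generalizing s with
  | nil =>
    refine (Runs.loop_done (by simp [hs])).congr ?_ (by simp)
    rw [← hs, update_eq_self]
  | cons x w ih =>
    refine (Runs.loop_step (by simp [hs]) (Runs.pop a s) (ih _ (by simp [hs]))).congr ?_ ?_
    · simp
    · simp only [List.length_cons]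
      omega

theorem runs_write {a : K} (v : List Bool) (s : K → List Bool) :
    Runs (write a v) s (update s a v) (2 * (s a).length + 1 + v.length) := by
  induction v with
  | nil => exact runs_clear _ s rfl
  | cons x v ih =>
    refine (ih.seq (Runs.push a x _)).congr (by simp) ?_
    simp only [List.length_cons]
    omega

end Basic

/-! ### A main stack with two auxiliary ones: copying words and splitting trees. -/

section Registers

variable {K : Type}

/-- The store in which only the main stack is nonempty. -/
def single (w : List Bool) : Option K → List Bool
  | none => w
  | some _ => []

/-- The store with given contents of the main stack and of two auxiliary stacks. -/
def regs (a b d : List Bool) : Option (Bool ⊕ K) → List Bool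
  | none => a
  | some (.inl false) => b
  | some (.inl true) => d
  | some (.inr _) => []

/-- The main stack. -/
abbrev main : Option (Bool ⊕ K) := none

/-- The first auxiliary stack. -/
abbrev aux : Option (Bool ⊕ K) := some (.inl false)

/-- The second auxiliary stack. -/
abbrev tmp : Option (Bool ⊕ K) := some (.inl true)

/-- Uses the main stack as the main stack of a subprogram. -/
def onMain {K' : Type} (j : K' → K) : Option K' → Option (Bool ⊕ K)
  | none => main
  | some k => some (.inr (j k))

/-- Uses the first auxiliary stack as the main stack of a subprogram. -/
def onAux {K' : Type} (j : K' → K) : Option K' → Option (Bool ⊕ K)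
  | none => aux
  | some k => some (.inr (j k))

theorem regs_nil_nil (w : List Bool) : regs w [] [] = single (K := Bool ⊕ K) w := by
  funext i
  rcases i with _ | (_ | _) | _ <;> rfl

variable [DecidableEq K]

theorem update_regs_main (a b d v : List Bool) :
    update (regs a b d) (main : Option (Bool ⊕ K)) v = regs v b d := by
  funext i
  rcases i with _ | (_ | _) | _ <;> simp [regs]

theorem update_regs_aux (a b d v : List Bool) :
    update (regs a b d) (aux : Option (Bool ⊕ K)) v = regs a v d := by
  funext i
  rcases i with _ | (_ | _) | _ <;> simp [regs]

theorem update_regs_tmp (a b d v : List Bool) :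
    update (regs a b d) (tmp : Option (Bool ⊕ K)) v = regs a b v := by
  funext i
  rcases i with _ | (_ | _) | _ <;> simp [regs]

theorem Runs.onMain {K' : Type} [DecidableEq K'] {j : K' → K} (hj : Injective j)
    {c : StackProg (Option K')} {v w : List Bool} {n : ℕ} (h : Runs c (single v) (single w) n)
    (b d : List Bool) : Runs (c.map (onMain j)) (regs v b d) (regs w b d) n := by
  refine h.map_of_eq ?_ ?_ ?_ ?_
  · rintro (_ | x) (_ | y) hxy <;> simp_all [StackProg.onMain, hj.eq_iff]
  · rintro (_ | x) <;> rfl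
  · rintro (_ | x) <;> rfl
  · rintro (_ | (_ | _) | _) hi
    · exact absurd ⟨none, rfl⟩ hi
    all_goals rfl

theorem Runs.onAux {K' : Type} [DecidableEq K'] {j : K' → K} (hj : Injective j)
    {c : StackProg (Option K')} {v w : List Bool} {n : ℕ} (h : Runs c (single v) (single w) n)
    (a d : List Bool) : Runs (c.map (onAux j)) (regs a v d) (regs a w d) n := by
  refine h.map_of_eq ?_ ?_ ?_ ?_
  · rintro (_ | x) (_ | y) hxy <;> simp_all [StackProg.onAux, hj.eq_iff]
  · rintro (_ | x) <;> rfl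
  · rintro (_ | x) <;> rfl
  · rintro (_ | (_ | _) | _) hi
    · rfl
    · exact absurd ⟨none, rfl⟩ hi
    all_goals rfl

theorem runs_move_aux_tmp (a b d : List Bool) :
    Runs (move (aux : Option (Bool ⊕ K)) tmp) (regs a b d) (regs a [] (b.reverse ++ d))
      (4 * b.length + 1) := by
  refine (runs_move (by simp) b _ rfl).congr ?_ le_rfl
  rw [update_regs_aux, update_regs_tmp]
  rfl

theorem runs_move_tmp_main (a b d : List Bool) :
    Runs (move (tmp : Option (Bool ⊕ K)) main) (regs a b d) (regs (d.reverse ++ a) b [])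
      (4 * d.length + 1) := by
  refine (runs_move (by simp) d _ rfl).congr ?_ le_rfl
  rw [update_regs_tmp, update_regs_main]
  rfl

theorem runs_push_main (x : Bool) (a b d : List Bool) :
    Runs (push (main : Option (Bool ⊕ K)) x) (regs a b d) (regs (x :: a) b d) 1 :=
  (Runs.push _ _ _).congr (update_regs_main _ _ _ _) le_rfl

theorem runs_clear_main (a b d : List Bool) :
    Runs (clear (main : Option (Bool ⊕ K))) (regs a b d) (regs [] b d) (2 * a.length + 1) :=
  (runs_clear a _ rfl).congr (update_regs_main _ _ _ _) le_rfl

theorem runs_clear_aux (a b d : List Bool) :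
    Runs (clear (aux : Option (Bool ⊕ K))) (regs a b d) (regs a [] d) (2 * b.length + 1) :=
  (runs_clear b _ rfl).congr (update_regs_aux _ _ _ _) le_rfl

theorem runs_clear_tmp (a b d : List Bool) :
    Runs (clear (tmp : Option (Bool ⊕ K))) (regs a b d) (regs a b []) (2 * d.length + 1) :=
  (runs_clear d _ rfl).congr (update_regs_tmp _ _ _ _) le_rfl

/-- Copies the main stack to the first auxiliary stack. -/
def copy : StackProg (Option (Bool ⊕ K)) :=
  seq (move main tmp) (moveTwo tmp main aux)

theorem runs_copy (w : List Bool) :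
    Runs (copy (K := K)) (regs w [] []) (regs w w []) (9 * w.length + 2) := by
  refine ((runs_move (by simp) w (regs w [] []) rfl).seq
    (runs_moveTwo (by simp) (by simp) (by simp) w.reverse _ ?_)).congr ?_ ?_
  · simp [regs]
  · simp only [update_regs_main, update_regs_aux, update_regs_tmp]
    simp [regs]
  · simp only [List.length_reverse]
    omega

/-- Moves the code of one tree for each symbol on the first auxiliary stack from the main stack to
the second auxiliary stack. -/
def splitLoop : StackProg (Option (Bool ⊕ K)) :=
  loop aux Option.isSome (cond main (· == some true)
    (seq (pop main) (seq (push tmp true) (push aux true)))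
    (seq (pop main) (seq (push tmp false) (pop aux))))

/-- The height of the first auxiliary stack counts the trees still to be moved: a leaf lowers it by
one, an inner node replaces one pending tree by two. Assuming a run `h` from the state after `x`
lets the induction hypotheses for the two subtrees be chained. -/
theorem runs_splitLoop (x : BinTree) (w y z : List Bool) (b : Bool)
    (t : Option (Bool ⊕ K) → List Bool) (n : ℕ)
    (h : Runs splitLoop (regs w z (x.code.reverse ++ y)) t n) :
    Runs splitLoop (regs (x.code ++ w) (b :: z) y) t (n + 5 * x.code.length) := by
  induction x generalizing w y z b n with
  | nil =>
    refine (Runs.loop_step rfl (m := 4) (.cond_false rfl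
      (((Runs.pop _ _).seq ((Runs.push _ _ _).seq (Runs.pop _ _))).congr ?_ le_rfl)) h).mono ?_
    · simp only [update_regs_main, update_regs_aux, update_regs_tmp]
      simp [regs, BinTree.code]
    · simp only [BinTree.code, List.length_cons, List.length_nil]
      omega
  | cons l r ihl ihr =>
    refine (Runs.loop_step (t := regs (l.code ++ (r.code ++ w)) (true :: b :: z) (true :: y)) rfl
      (m := 4) (.cond_true rfl
      (((Runs.pop _ _).seq ((Runs.push _ _ _).seq (Runs.push _ _ _))).congr ?_ le_rfl))
      (ihl _ _ _ _ _ (ihr _ _ _ _ n ?_))).mono ?_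
    · simp only [update_regs_main, update_regs_aux, update_regs_tmp]
      simp [regs, BinTree.code]
    · simpa [BinTree.code] using h
    · simp only [BinTree.code, List.length_cons, List.length_append]
      omega

/-- Splits a nonempty tree on the main stack into its two parts. -/
def split : StackProg (Option (Bool ⊕ K)) :=
  seq (pop main) (seq (push aux true) splitLoop)

theorem runs_split (x y : BinTree) :
    Runs (split (K := K)) (regs (BinTree.cons x y).code [] []) (regs y.code [] x.code.reverse)
      (5 * (BinTree.cons x y).code.length) := by
  refine ((Runs.pop _ _).seq ((Runs.push _ _ _).seq (n := 5 * x.code.length + 1) ?_)).mono ?_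
  · simp only [update_regs_main, update_regs_aux]
    have h := runs_splitLoop x y.code [] [] true (regs y.code [] x.code.reverse) 1
      (by rw [List.append_nil]; exact Runs.loop_done (K := Option (Bool ⊕ K)) rfl)
    simpa [regs, BinTree.code, Nat.add_comm] using h
  · simp only [BinTree.code, List.length_cons, List.length_append]
    omega

end Registers

end StackProg

open TreeRep StackProg

/-! ### Closure properties of polynomial-time computability. -/

theorem polynomial_eval_mono (q : Polynomial ℕ) {m n : ℕ} (h : m ≤ n) : q.eval m ≤ q.eval n := by
  simp only [Polynomial.eval_eq_sum, Polynomial.sum]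
  gcongr

/-- The function `f` is computed in polynomial time by a structured stack program. -/
def PolyTime {α β : Type} [TreeRep α] [TreeRep β] (f : α → β) : Prop :=
  ∃ (K : Type) (_ : Fintype K) (_ : DecidableEq K) (c : StackProg (Option K)) (q : Polynomial ℕ),
    ∀ a, Runs c (single (word a)) (single (word (f a))) (q.eval (size a)) ∧
      size (f a) ≤ q.eval (size a)

namespace PolyTime

variable {α β γ δ : Type} [TreeRep α] [TreeRep β] [TreeRep γ] [TreeRep δ]

/-- Passing to functions whose inputs and outputs are represented by the same trees. -/
theorem of_tree_eq {f : α → β} (hf : PolyTime f) {g : γ → δ} (e : γ → α)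
    (he : ∀ c, tree (e c) = tree c) (hg : ∀ c, tree (f (e c)) = tree (g c)) : PolyTime g := by
  obtain ⟨K, _, _, c, q, h⟩ := hf
  refine ⟨K, inferInstance, inferInstance, c, q, fun a => ?_⟩
  have := h (e a)
  rwa [word_eq_of_tree_eq (he a), word_eq_of_tree_eq (hg a), size_eq_of_tree_eq (he a),
    size_eq_of_tree_eq (hg a)] at this

theorem const (b : β) : PolyTime fun _ : α => b := by
  refine ⟨Empty, inferInstance, inferInstance, write none (word b),
    2 * Polynomial.X + 1 + Polynomial.C (size b), fun a => ⟨?_, ?_⟩⟩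
  · refine (runs_write (word b) (single (word a))).congr ?_ ?_
    · funext i
      rcases i with _ | i
      · simp [single]
      · exact i.elim
    · simp [single, size]
  · simp

theorem of_same_tree {f : α → β} (h : ∀ a, tree (f a) = tree a) : PolyTime f := by
  -- There is no instruction that does nothing; a push followed by a pop replaces it.
  refine ⟨Empty, inferInstance, inferInstance, seq (push none true) (pop none),
    2 + Polynomial.X, fun a => ⟨?_, ?_⟩⟩
  · refine ((Runs.push _ _ _).seq (Runs.pop _ _)).congr ?_ ?_
    · simp [word_eq_of_tree_eq (h a)]
    · simp
  · simp [size_eq_of_tree_eq (h a)]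

theorem id : PolyTime fun a : α => a := of_same_tree fun _ => rfl

/-- The output size bound in `PolyTime` controls the intermediate value, giving time `q + p ∘ q`.
Each program receives its own auxiliary stacks and leaves them empty. -/
theorem comp {f : β → γ} {g : α → β} (hf : PolyTime f) (hg : PolyTime g) :
    PolyTime fun a => f (g a) := by
  obtain ⟨K₁, _, _, c, p, hc⟩ := hf
  obtain ⟨K₂, _, _, d, q, hd⟩ := hg
  refine ⟨Bool ⊕ (K₁ ⊕ K₂), inferInstance, inferInstance,
    seq (d.map (onMain Sum.inr)) (c.map (onMain Sum.inl)), q + p.comp q, fun a => ⟨?_, ?_⟩⟩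
  · obtain ⟨h₁, h₂⟩ := hd a
    obtain ⟨h₃, h₄⟩ := hc (g a)
    rw [← regs_nil_nil, ← regs_nil_nil]
    refine ((h₁.onMain Sum.inr_injective _ _).seq (h₃.onMain Sum.inl_injective _ _)).mono ?_
    simpa using polynomial_eval_mono p h₂
  · refine (hc (g a)).2.trans ((polynomial_eval_mono p (hd a).2).trans ?_)
    simp

theorem pair {f : α → β} {g : α → γ} (hf : PolyTime f) (hg : PolyTime g) :
    PolyTime fun a => (f a, g a) := by
  obtain ⟨K₁, _, _, c, p, hc⟩ := hf
  obtain ⟨K₂, _, _, d, q, hd⟩ := hg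
  refine ⟨Bool ⊕ (K₁ ⊕ K₂), inferInstance, inferInstance,
    seq copy (seq (c.map (onAux Sum.inl)) (seq (d.map (onMain Sum.inr))
      (seq (move aux tmp) (seq (move tmp main) (push main true))))),
    9 * Polynomial.X + 9 * p + q + 9, fun a => ⟨?_, ?_⟩⟩
  · obtain ⟨h₁, h₂⟩ := hc a
    obtain ⟨h₃, h₄⟩ := hd a
    rw [← regs_nil_nil, ← regs_nil_nil]
    refine ((runs_copy _).seq ((h₁.onAux Sum.inl_injective _ _).seq
      ((h₃.onMain Sum.inr_injective _ _).seq ((runs_move_aux_tmp _ _ _).seq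
        ((runs_move_tmp_main _ _ _).seq (runs_push_main _ _ _ _)))))).congr ?_ ?_
    · simp [word_pair]
    · simp only [List.length_reverse, List.append_nil, Polynomial.eval_add, Polynomial.eval_mul,
        Polynomial.eval_X, Polynomial.eval_ofNat]
      change 9 * size a + 2 + (_ + (_ + (4 * size _ + 1 + (4 * size _ + 1 + 1)))) ≤ _
      omega
  · have h₁ := (hc a).2
    have h₂ := (hd a).2
    simp only [size_pair, Polynomial.eval_add, Polynomial.eval_mul, Polynomial.eval_X,
      Polynomial.eval_ofNat]
    omega

theorem fst : PolyTime fun x : α × β => x.1 := by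
  refine ⟨Bool ⊕ Empty, inferInstance, inferInstance,
    seq split (seq (clear main) (move tmp main)), 20 * Polynomial.X, fun x => ⟨?_, ?_⟩⟩
  · have hs : size x = _ := size_pair x.1 x.2
    rw [← regs_nil_nil, ← regs_nil_nil]
    refine ((runs_split _ _).seq ((runs_clear_main _ _ _).seq
      (runs_move_tmp_main _ _ _))).congr ?_ ?_
    · simp [word]
    · simp only [List.length_reverse, Polynomial.eval_mul, Polynomial.eval_X,
        Polynomial.eval_ofNat]
      change 5 * size x + (2 * size x.2 + 1 + (4 * size x.1 + 1)) ≤ 20 * size x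
      omega
  · have hs : size x = _ := size_pair x.1 x.2
    simp only [Polynomial.eval_mul, Polynomial.eval_X, Polynomial.eval_ofNat]
    omega

theorem snd : PolyTime fun x : α × β => x.2 := by
  refine ⟨Bool ⊕ Empty, inferInstance, inferInstance,
    seq split (clear tmp), 20 * Polynomial.X, fun x => ⟨?_, ?_⟩⟩
  · have hs : size x = _ := size_pair x.1 x.2
    rw [← regs_nil_nil, ← regs_nil_nil]
    refine ((runs_split _ _).seq (runs_clear_tmp _ _ _)).congr rfl ?_
    simp only [List.length_reverse, Polynomial.eval_mul, Polynomial.eval_X,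
        Polynomial.eval_ofNat]
    change 5 * size x + (2 * size x.1 + 1) ≤ 20 * size x
    omega
  · have hs : size x = _ := size_pair x.1 x.2
    simp only [Polynomial.eval_mul, Polynomial.eval_X, Polynomial.eval_ofNat]
    omega

/-- Case distinction according to whether a value is represented by the empty tree. -/
theorem ite {h : α → β} {P : α → Prop} [DecidablePred P] {f g : α → γ} (hh : PolyTime h)
    (hP : ∀ a, P a ↔ tree (h a) ≠ .nil) (hf : PolyTime fun a : {a // P a} => f a)
    (hg : PolyTime fun a : {a // ¬ P a} => g a) :
    PolyTime fun a => if P a then f a else g a := by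
  obtain ⟨K₁, _, _, c₁, q₁, h₁⟩ := hh
  obtain ⟨K₂, _, _, c₂, q₂, h₂⟩ := hf
  obtain ⟨K₃, _, _, c₃, q₃, h₃⟩ := hg
  refine ⟨Bool ⊕ (K₁ ⊕ (K₂ ⊕ K₃)), inferInstance, inferInstance,
    seq copy (seq (c₁.map (onAux Sum.inl)) (cond aux (· == some true)
      (seq (clear aux) (c₂.map (onMain fun k => Sum.inr (Sum.inl k))))
      (seq (clear aux) (c₃.map (onMain fun k => Sum.inr (Sum.inr k)))))),
    9 * Polynomial.X + 3 * q₁ + q₂ + q₃ + 4, fun a => ?_⟩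
  obtain ⟨h₄, h₅⟩ := h₁ a
  simp only [Polynomial.eval_add, Polynomial.eval_mul, Polynomial.eval_X, Polynomial.eval_ofNat]
  have ha := BinTree.head?_code (tree (h a))
  rw [← hP] at ha
  have hc : Runs (copy (K := K₁ ⊕ (K₂ ⊕ K₃))) _ _ (9 * size a + 2) := runs_copy (word a)
  have hcl (x y : List Bool) : Runs (clear (aux : Option (Bool ⊕ (K₁ ⊕ (K₂ ⊕ K₃)))))
    (regs x (word (h a)) y) _ (2 * size (h a) + 1) := runs_clear_aux _ _ _
  rw [← regs_nil_nil, ← regs_nil_nil]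
  by_cases hPa : P a
  · have h₆ := h₂ ⟨a, hPa⟩
    rw [if_pos hPa]
    change Runs c₂ (single (word a)) (single (word (f a))) (q₂.eval (size a)) ∧
      size (f a) ≤ q₂.eval (size a) at h₆
    refine ⟨?_, by omega⟩
    refine (hc.seq ((h₄.onAux Sum.inl_injective _ _).seq (.cond_true ?_ ((hcl _ _).seq
      (h₆.1.onMain (Sum.inr_injective.comp Sum.inl_injective) _ _))))).mono ?_
    · simpa [regs, word] using ha.2 hPa
    · omega
  · have h₆ := h₃ ⟨a, hPa⟩
    rw [if_neg hPa]
    change Runs c₃ (single (word a)) (single (word (g a))) (q₃.eval (size a)) ∧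
      size (g a) ≤ q₃.eval (size a) at h₆
    refine ⟨?_, by omega⟩
    refine (hc.seq ((h₄.onAux Sum.inl_injective _ _).seq (.cond_false ?_ ((hcl _ _).seq
      (h₆.1.onMain (Sum.inr_injective.comp Sum.inr_injective) _ _))))).mono ?_
    · simpa [regs, word] using mt ha.1 hPa
    · omega

/-- Iteration of a function for as long as a test returns a value that is not represented by the
empty tree. -/
theorem iterate {h : α → β} {F G : α → α} (hh : PolyTime h) (hF : PolyTime F) (q : Polynomial ℕ)
    (hq : ∀ a, ∃ n ≤ q.eval (size a), (∀ i < n, tree (h (F^[i] a)) ≠ .nil) ∧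
      tree (h (F^[n] a)) = .nil ∧ G a = F^[n] a ∧ ∀ i ≤ n, size (F^[i] a) ≤ q.eval (size a)) :
    PolyTime G := by
  obtain ⟨K₁, _, _, c, q₁, h₁⟩ := hh
  obtain ⟨K₂, _, _, d, q₂, h₂⟩ := hF
  let test : StackProg (Option (Bool ⊕ (K₁ ⊕ K₂))) := seq copy (c.map (onAux Sum.inl))
  let body := seq (clear aux) (seq (d.map (onMain Sum.inr)) test)
  let prog := loop aux (· == some true) body
  -- The cost of one round: clear the old test result, apply `F`, copy the state, evaluate the test
  -- on the copy, and branch. All states have size at most `q`; without this hypothesis, iteration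
  -- could make sizes explode.
  let b : Polynomial ℕ := 9 * q + 3 * q₁.comp q + q₂.comp q + 4
  refine ⟨Bool ⊕ (K₁ ⊕ K₂), inferInstance, inferInstance, seq test (seq prog (clear aux)),
    (q + 1) * b + 10, fun a => ?_⟩
  obtain ⟨n, hn, hne, hnil, hG, hsize⟩ := hq a
  have htest (i : ℕ) (hi : i ≤ n) : Runs test (regs (word (F^[i] a)) [] [])
      (regs (word (F^[i] a)) (word (h (F^[i] a))) [])
      (9 * q.eval (size a) + 2 + q₁.eval (q.eval (size a))) := by
    refine ((runs_copy _).seq ((h₁ _).1.onAux Sum.inl_injective _ _)).mono ?_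
    have := polynomial_eval_mono q₁ (hsize i hi)
    have := hsize i hi
    change 9 * size _ + 2 + _ ≤ _
    omega
  have hb : b.eval (size a) = 9 * q.eval (size a) + 3 * q₁.eval (q.eval (size a)) +
      q₂.eval (q.eval (size a)) + 4 := by
    simp [b]
  have hcl (i : ℕ) (hi : i ≤ n) (x : List Bool) : Runs (clear aux)
      (regs (K := K₁ ⊕ K₂) x (word (h (F^[i] a))) []) (regs x [] [])
      (2 * q₁.eval (q.eval (size a)) + 1) := by
    refine (runs_clear_aux _ _ _).mono ?_
    have := polynomial_eval_mono q₁ (hsize i hi)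
    have := (h₁ (F^[i] a)).2
    change 2 * size _ + 1 ≤ _
    omega
  have hloop (j i : ℕ) (hij : i + j = n) : Runs prog
      (regs (word (F^[i] a)) (word (h (F^[i] a))) [])
      (regs (word (F^[n] a)) (word (h (F^[n] a))) []) (j * b.eval (size a) + 1) := by
    induction j generalizing i with
    | zero =>
      obtain rfl : i = n := by omega
      refine (Runs.loop_done ?_).mono (by omega)
      simp [regs, word, hnil, BinTree.code]
    | succ j ih =>
      refine (Runs.loop_step ?_ ((hcl i (by omega) _).seq
        (((h₂ _).1.onMain Sum.inr_injective _ _).seq ?_)) (ih (i + 1) (by omega))).mono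
        (m := (2 * q₁.eval (q.eval (size a)) + 1 + (q₂.eval (size (F^[i] a)) +
          (9 * q.eval (size a) + 2 + q₁.eval (q.eval (size a))))) + (j * b.eval (size a) + 1) + 1)
        ?_
      · have := (BinTree.head?_code _).2 (hne i (by omega))
        simpa [regs, word] using this
      · have := htest (i + 1) (by omega)
        rwa [iterate_succ_apply'] at this ⊢
      · have := polynomial_eval_mono q₂ (hsize i (by omega))
        rw [Nat.add_mul, Nat.one_mul, hb]
        omega
  have hmul : n * b.eval (size a) ≤ q.eval (size a) * b.eval (size a) := Nat.mul_le_mul_right _ hn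
  simp only [Polynomial.eval_add, Polynomial.eval_mul, Polynomial.eval_one, Polynomial.eval_ofNat]
  rw [Nat.add_mul, Nat.one_mul]
  constructor
  · rw [← regs_nil_nil, ← regs_nil_nil, hG]
    refine ((htest 0 (Nat.zero_le _)).seq ((hloop n 0 (by omega)).seq (hcl n le_rfl _))).mono ?_
    omega
  · have := hsize n le_rfl
    rw [hG]
    omega

end PolyTime

namespace PolyTime

variable {α β γ δ σ : Type} [TreeRep α] [TreeRep β] [TreeRep γ] [TreeRep δ] [TreeRep σ]

/-! ### Booleans and case distinctions -/

theorem congr {f g : α → β} (hf : PolyTime f) (h : ∀ a, f a = g a) : PolyTime g :=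
  funext h ▸ hf

theorem val {P : α → Prop} : PolyTime fun a : {a // P a} => a.1 := of_same_tree fun _ => rfl

theorem restrict {f : α → β} (hf : PolyTime f) {P : α → Prop} :
    PolyTime fun a : {a // P a} => f a :=
  hf.comp val

theorem cond {b : α → Bool} {f g : α → β} (hb : PolyTime b) (hf : PolyTime f) (hg : PolyTime g) :
    PolyTime fun a => if b a then f a else g a :=
  ite hb (fun a => by cases b a <;> simp [tree_true, tree_false]) hf.restrict hg.restrict

theorem not {b : α → Bool} (hb : PolyTime b) : PolyTime fun a => !b a :=
  (hb.cond (const false) (const true)).congr fun a => by cases b a <;> rfl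

theorem and {b c : α → Bool} (hb : PolyTime b) (hc : PolyTime c) : PolyTime fun a => b a && c a :=
  (hb.cond hc (const false)).congr fun a => by cases b a <;> rfl

theorem or {b c : α → Bool} (hb : PolyTime b) (hc : PolyTime c) : PolyTime fun a => b a || c a :=
  (hb.cond (const true) hc).congr fun a => by cases b a <;> rfl

theorem beq {b c : α → Bool} (hb : PolyTime b) (hc : PolyTime c) : PolyTime fun a => b a == c a :=
  (hb.cond hc hc.not).congr fun a => by cases b a <;> cases c a <;> rfl

/-! ### Lists -/

theorem cons {f : α → β} {l : α → List β} (hf : PolyTime f) (hl : PolyTime l) :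
    PolyTime fun a => f a :: l a :=
  (hf.pair hl).of_tree_eq (fun a => a) (fun _ => rfl) fun _ => rfl

/-- A nonempty list has the same tree as the pair of its head and tail, so taking it apart costs
nothing, and emptiness of the list is emptiness of the tree. The subtype of arguments with nonempty
list avoids a default value for the head. -/
theorem listCases {l : α → List β} {g : α → γ} {f : α → β → List β → γ} (hl : PolyTime l)
    (hg : PolyTime g) (hf : PolyTime fun x : α × β × List β => f x.1 x.2.1 x.2.2) :
    PolyTime fun a => match l a with
      | [] => g a
      | b :: t => f a b t := by
  have h₁ : PolyTime fun a : {a // l a ≠ []} => (a.1, (l a).head a.2, (l a).tail) :=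
    (id.pair hl).of_tree_eq (fun a => a.1) (fun _ => rfl) fun a => by
      simp only [tree_pair]
      rw [← tree_cons, List.cons_head_tail]
  have h₂ : PolyTime fun a : {a // ¬ l a ≠ []} => g a := hg.restrict
  have h₃ : PolyTime fun a : {a // l a ≠ []} => match l a with
      | [] => g a
      | b :: t => f a b t :=
    (hf.comp h₁).congr fun ⟨a, ha⟩ => by
      obtain ⟨b, t, h⟩ := List.exists_cons_of_ne_nil ha
      simp [h]
  refine (ite (P := fun a => l a ≠ []) (f := fun a => match l a with
      | [] => g a
      | b :: t => f a b t) hl (fun a => ?_) h₃ h₂).congr fun a => ?_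
  · cases l a <;> simp [tree_nil, tree_cons]
  · cases l a <;> simp

theorem isEmpty {l : α → List β} (hl : PolyTime l) : PolyTime fun a => (l a).isEmpty :=
  (hl.listCases (f := fun _ _ _ => false) (const true) (const false)).congr fun a => by
    cases l a <;> rfl

theorem headD {l : α → List β} (hl : PolyTime l) (b : β) : PolyTime fun a => (l a).headD b :=
  (hl.listCases (f := fun _ c _ => c) (const b) (fst.comp snd)).congr fun a => by
    cases l a <;> rfl

theorem tail {l : α → List β} (hl : PolyTime l) : PolyTime fun a => (l a).tail :=
  (hl.listCases (f := fun _ _ t => t) (const []) (snd.comp snd)).congr fun a => by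
    cases l a <;> rfl

/-- The fold is an iteration on triples of unread list, parameter and accumulator. By `hq` a round
enlarges the accumulator by an amount that depends only on the parameter and the list element, so
the growth over all rounds is additive and stays polynomial. -/
theorem foldl {l : α → List β} {i : α → σ} {f : α → σ → β → σ} (hl : PolyTime l)
    (hi : PolyTime i) (hf : PolyTime fun x : α × σ × β => f x.1 x.2.1 x.2.2) (q : Polynomial ℕ)
    (hq : ∀ a s b, size (f a s b) ≤ size s + q.eval (size a + size b)) :
    PolyTime fun a => (l a).foldl (f a) (i a) := by
  let step : List β × α × σ → List β × α × σ := fun x => match x.1 with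
    | [] => x
    | b :: t => (t, x.2.1, f x.2.1 x.2.2 b)
  have hstep : PolyTime step :=
    fst.listCases (f := fun x b t => (t, x.2.1, f x.2.1 x.2.2 b)) id
      ((snd.comp snd).pair ((fst.comp (snd.comp fst)).pair
        (hf.comp ((fst.comp (snd.comp fst)).pair
          ((snd.comp (snd.comp fst)).pair (fst.comp snd))))))
  have hiter : ∀ (m : List β) (a : α) (s : σ),
      (∀ i < m.length, tree (step^[i] (m, a, s)).1 ≠ .nil) ∧
        step^[m.length] (m, a, s) = ([], a, m.foldl (f a) s) := by
    intro m
    induction m with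
    | nil => exact fun a s => ⟨fun i hi => absurd hi (Nat.not_lt_zero i), rfl⟩
    | cons b t ih =>
      intro a s
      refine ⟨fun i hi => ?_, ?_⟩
      · rcases i with _ | i
        · simp [tree_cons]
        · rw [iterate_succ_apply]
          exact (ih _ _).1 i (by simpa using hi)
      · rw [List.length_cons, iterate_succ_apply]
        exact (ih _ _).2
  have hsize : ∀ (i : ℕ) (m : List β) (a : α) (s : σ) (N : ℕ), (∀ b ∈ m, size a + size b ≤ N) →
      size (step^[i] (m, a, s)) ≤ size (m, a, s) + i * q.eval N := by
    intro i
    induction i with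
    | zero => intros; simp
    | succ i ih =>
      intro m a s N hN
      rw [iterate_succ_apply]
      rcases m with _ | ⟨b, t⟩
      · refine (ih [] a s N (by simp)).trans ?_
        rw [Nat.add_mul]
        omega
      · refine (ih t a _ N fun c hc => hN c (List.mem_cons_of_mem _ hc)).trans ?_
        have h₁ := hq a s b
        have h₂ := polynomial_eval_mono q (hN b List.mem_cons_self)
        simp only [size_pair, size_cons, Nat.add_mul]
        omega
  have hmem : ∀ (m : List β) (b : β), b ∈ m → size b ≤ size m := by
    intro m b hb
    induction hb with
    | head t => rw [size_cons]; omega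
    | tail c _ ih => rw [size_cons]; omega
  have hlength : ∀ m : List β, m.length ≤ size m := by
    intro m
    induction m with
    | nil => simp
    | cons b t ih => rw [size_cons, List.length_cons]; omega
  have hloop : PolyTime fun x : List β × α × σ =>
      (([], x.2.1, x.1.foldl (f x.2.1) x.2.2) : List β × α × σ) := by
    -- The number of rounds is at most the initial size, and each round adds at most `q` of that
    -- size.
    refine iterate fst hstep (Polynomial.X + Polynomial.X * q) ?_
    rintro ⟨m, a, s⟩
    have h₀ := size_pair m (a, s)
    have h₁ := size_pair a s
    have h₂ := hlength m
    simp only [Polynomial.eval_add, Polynomial.eval_mul, Polynomial.eval_X]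
    refine ⟨m.length, by omega, (hiter m a s).1, ?_, (hiter m a s).2.symm, fun i hi => ?_⟩
    · rw [(hiter m a s).2]
      rfl
    · refine (hsize i m a s (size (m, a, s)) fun b hb => ?_).trans ?_
      · have := hmem m b hb
        omega
      · gcongr
        omega
  exact snd.comp (snd.comp (hloop.comp (hl.pair (id.pair hi))))

theorem reverseAux {l m : α → List β} (hl : PolyTime l) (hm : PolyTime m) :
    PolyTime fun a => (l a).reverse ++ m a := by
  refine (hl.foldl (f := fun _ s b => b :: s) hm ((snd.comp snd).cons (fst.comp snd))
    (Polynomial.X + 1) fun a s b => ?_).congr fun a => ?_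
  · simp only [size_cons, Polynomial.eval_add, Polynomial.eval_X, Polynomial.eval_one]
    omega
  · simp

theorem reverse {l : α → List β} (hl : PolyTime l) : PolyTime fun a => (l a).reverse :=
  (hl.reverseAux (const [])).congr fun a => by simp

theorem foldl_cond_cons {ε : Type} (p : ε → Bool) (l s : List ε) :
    l.foldl (fun s b => if p b then b :: s else s) s = (l.filter p).reverse ++ s := by
  induction l generalizing s with
  | nil => rfl
  | cons b l ih =>
    rw [List.foldl_cons, ih]
    by_cases h : p b <;> simp [h]

theorem filter {l : α → List β} {p : α → β → Bool} (hl : PolyTime l)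
    (hp : PolyTime fun x : α × β => p x.1 x.2) : PolyTime fun a => (l a).filter (p a) := by
  refine (hl.foldl (f := fun a s b => if p a b then b :: s else s) (const [])
    ((hp.comp (fst.pair (snd.comp snd))).cond ((snd.comp snd).cons (fst.comp snd)) (fst.comp snd))
    (Polynomial.X + 1) fun a s b => ?_).reverse.congr fun a => ?_
  · simp only [Polynomial.eval_add, Polynomial.eval_X, Polynomial.eval_one]
    split
    · rw [size_cons]
      omega
    · omega
  · rw [foldl_cond_cons]
    simp

theorem any {l : α → List β} {p : α → β → Bool} (hl : PolyTime l)
    (hp : PolyTime fun x : α × β => p x.1 x.2) : PolyTime fun a => (l a).any (p a) :=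
  (hl.filter hp).isEmpty.not.congr fun a => by
    induction l a with
    | nil => rfl
    | cons b t ih => by_cases h : p a b <;> simp_all

/-- Comparison of the lengths of two lists. -/
theorem length_lt {l : α → List β} {m : α → List γ} (hl : PolyTime l) (hm : PolyTime m) :
    PolyTime fun a => decide ((l a).length < (m a).length) := by
  -- One element of `m` is dropped for each element of `l`; something is left exactly when `m` is
  -- longer.
  refine (hl.foldl (f := fun _ s _ => s.tail) hm (fst.comp snd).tail 0
    fun a s b => ?_).isEmpty.not.congr fun a => ?_
  · cases s
    · simp
    · rw [List.tail_cons, size_cons]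
      omega
  · have h : ∀ (l : List β) (m : List γ), l.foldl (fun s _ => s.tail) m = m.drop l.length := by
      intro l
      induction l with
      | nil => intro m; rfl
      | cons b t ih =>
        intro m
        rw [List.foldl_cons, ih]
        simp [List.drop_tail]
    simp only [h]
    rw [Bool.eq_iff_iff]
    simp

/-! ### Binary numbers -/

/-- One step of the comparison of two lists of bits. -/
def matchBit (s : Bool × List Bool) (b : Bool) : Bool × List Bool :=
  match s.2 with
  | [] => (false, [])
  | c :: t => (s.1 && (b == c), t)

/-- The flag says whether all bits read so far agree, and the second component is the unread part of
`m`. If `m` runs out too early the flag becomes false for good; if it is too long, a nonempty rest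
remains. -/
theorem foldl_matchBit (l m : List Bool) (ok : Bool) :
    ((l.foldl matchBit (ok, m)).1 && (l.foldl matchBit (ok, m)).2.isEmpty) =
      (ok && decide (l = m)) := by
  induction l generalizing ok m with
  | nil => cases m <;> simp
  | cons b l ih =>
    rw [List.foldl_cons]
    cases m with
    | nil => simp [matchBit, ih]
    | cons c m =>
      simp only [matchBit, ih]
      cases b <;> cases c <;> simp

theorem bits_eq {l m : α → List Bool} (hl : PolyTime l) (hm : PolyTime m) :
    PolyTime fun a => decide (l a = m a) := by
  have hstep : PolyTime fun x : α × (Bool × List Bool) × Bool => matchBit x.2.1 x.2.2 :=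
    ((snd.comp (fst.comp snd)).listCases
      (f := fun (x : α × (Bool × List Bool) × Bool) c t => (x.2.1.1 && (x.2.2 == c), t))
      (const (false, []))
      (((fst.comp (fst.comp (snd.comp fst))).and
        ((snd.comp (snd.comp fst)).beq (fst.comp snd))).pair (snd.comp snd))).congr
      fun x => by rcases x with ⟨a, ⟨ok, _ | ⟨c, t⟩⟩, b⟩ <;> rfl
  have h := hl.foldl (f := fun _ s b => matchBit s b) ((const true).pair hm) hstep 2 ?_
  · exact ((fst.comp h).and (snd.comp h).isEmpty).congr fun a => by
      simpa using foldl_matchBit (l a) (m a) true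
  · rintro a ⟨ok, m⟩ b
    simp only [Polynomial.eval_ofNat]
    have := one_le_size ok
    rcases m with _ | ⟨c, t⟩
    · simp only [matchBit, size_pair]
      have := size_bool_le false
      omega
    · simp only [matchBit, size_pair, size_cons]
      have := size_bool_le (ok && (b == c))
      omega

/-- Every second element of a list, in reverse order. -/
def halve {ε : Type} (l : List ε) : List ε :=
  (l.foldl (fun s b => (!s.1, if s.1 then s.2 else b :: s.2)) (false, [])).2

/-- The first element is kept, so odd lengths round up; `foldl_removeBit_eq_nil` depends on this
rounding. -/
theorem length_halve {ε : Type} (l : List ε) : (halve l).length = (l.length + 1) / 2 := by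
  have h : ∀ (l : List ε) (s : Bool × List ε),
      (l.foldl (fun s b => (!s.1, if s.1 then s.2 else b :: s.2)) s).2.length =
        s.2.length + (l.length + bif s.1 then 0 else 1) / 2 := by
    intro l
    induction l with
    | nil => rintro ⟨_ | _, s⟩ <;> simp
    | cons b t ih =>
      rintro ⟨_ | _, s⟩
      · simp only [List.foldl_cons, ih, List.length_cons]
        simp
        omega
      · simp only [List.foldl_cons, ih, List.length_cons]
        simp
  simpa [halve] using h l (false, [])

theorem size_halve_le (l : List β) : size (halve l) ≤ size l := by
  have h : ∀ (l : List β) (s : Bool × List β),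
      size (l.foldl (fun s b => (!s.1, if s.1 then s.2 else b :: s.2)) s).2 + 1 ≤
        size s.2 + size l := by
    intro l
    induction l with
    | nil => intro s; simp [size_nil]
    | cons b t ih =>
      intro s
      rw [List.foldl_cons]
      refine (ih _).trans ?_
      dsimp only
      split
      · rw [size_cons]
        omega
      · rw [size_cons, size_cons]
        omega
  have := h l (false, [])
  rw [size_nil] at this
  unfold halve
  omega

theorem polyTime_halve : PolyTime (halve : List β → List β) := by
  refine snd.comp (id.foldl (α := List β) (σ := Bool × List β)
    (f := fun _ s b => (!s.1, if s.1 then s.2 else b :: s.2)) (const (false, []))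
    ((fst.comp (fst.comp snd)).not.pair ((fst.comp (fst.comp snd)).cond (snd.comp (fst.comp snd))
      ((snd.comp snd).cons (snd.comp (fst.comp snd))))) (Polynomial.X + 3) ?_)
  rintro a ⟨c, s⟩ b
  simp only [size_pair, Polynomial.eval_add, Polynomial.eval_X, Polynomial.eval_ofNat]
  have := size_bool_le !c
  have := one_le_size c
  have := one_le_size a
  split
  · omega
  · rw [size_cons]
    omega

/-- The number with a given list of bits, the least significant bit first. -/
def ofBits : List Bool → ℕ
  | [] => 0
  | b :: l => b.toNat + 2 * ofBits l

theorem ofBits_encodeNat (n : ℕ) : ofBits (encodeNat n) = n := by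
  have h : ∀ n : PosNum, ofBits (encodePosNum n) = (n : ℕ) := by
    intro n
    induction n with
    | one => rfl
    | bit0 n ih => simp [encodePosNum, ofBits, ih, two_mul]
    | bit1 n ih => simp [encodePosNum, ofBits, ih, two_mul, Nat.add_comm]
  have h' : ∀ n : Num, ofBits (encodeNum n) = (n : ℕ) := by
    rintro (_ | n)
    · rfl
    · exact h n
  rw [encodeNat, h', Num.to_of_nat]

/-- One step of the comparison of the length of a list with a binary number. -/
def removeBit {ε : Type} (l : List ε) (b : Bool) : List ε :=
  halve (if b then l.tail else l)

/-- With truncated subtraction, `⌈(n - b) / 2⌉ ≤ m` if and only if `n ≤ b + 2 * m`, so each bit,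
least significant first, halves the question. The number is never expanded into unary, which would
be exponential for a binary `kDC`. -/
theorem foldl_removeBit_eq_nil {ε : Type} (bits : List Bool) (l : List ε) :
    bits.foldl removeBit l = [] ↔ l.length ≤ ofBits bits := by
  induction bits generalizing l with
  | nil => simp [ofBits]
  | cons b bits ih =>
    rw [List.foldl_cons, ih, removeBit, length_halve, ofBits]
    cases b
    · simp
      omega
    · simp
      omega

/-- A natural number is represented by its binary expansion. -/
instance instTreeRepNat : TreeRep ℕ := ⟨fun n => tree (encodeNat n)⟩

theorem encodeNat {f : α → ℕ} (hf : PolyTime f) : PolyTime fun a => encodeNat (f a) :=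
  hf.of_tree_eq (fun a => a) (fun _ => rfl) fun _ => rfl

theorem nat_eq {f g : α → ℕ} (hf : PolyTime f) (hg : PolyTime g) :
    PolyTime fun a => decide (f a = g a) :=
  (hf.encodeNat.bits_eq hg.encodeNat).congr fun a => by
    rw [decide_eq_decide]
    exact encodingNatBool.encode_injective.eq_iff

theorem length_le_nat {l : α → List β} {f : α → ℕ} (hl : PolyTime l) (hf : PolyTime f) :
    PolyTime fun a => decide ((l a).length ≤ f a) := by
  refine (hf.encodeNat.foldl (f := fun _ s b => removeBit s b) hl (polyTime_halve.comp
    ((snd.comp snd).cond (fst.comp snd).tail (fst.comp snd))) 0 fun a s b => ?_).isEmpty.congr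
      fun a => ?_
  · refine (size_halve_le _).trans ?_
    rcases s with _ | ⟨c, s⟩
    · simp
    · split
      · simp only [List.tail_cons, size_cons]
        omega
      · simp
  · rw [Bool.eq_iff_iff, List.isEmpty_iff, decide_eq_true_iff, foldl_removeBit_eq_nil,
      ofBits_encodeNat]

end PolyTime

/-! # Turing machines for polynomial-time functions of strings -/

/-- Three bits that represent an input symbol. -/
def symbolBits : Γ' → Bool × Bool × Bool
  | .bit b => (false, b, false)
  | .comma => (true, false, false)
  | .ket => (true, true, false)
  | .bra => (true, true, true)
  | .blank => (true, true, true)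

theorem size_symbolBits_le (s : Γ') : size (symbolBits s) ≤ 11 := by
  have h : ∀ x : Bool × Bool × Bool, size x ≤ 11 := by decide
  exact h _

namespace StackProg

variable {K : Type}

/-- Pushes a string on a stack. -/
def pushAll {Λ : Type} (k : K) :
    List Bool → TM2.Stmt (Alphabet K) Λ (Option Γ') → TM2.Stmt (Alphabet K) Λ (Option Γ')
  | [], q => q
  | x :: w, q => pushAll k w (.push (some k) (fun _ => x) q)

/-- Pushes the representation of the symbol read last, which has to be one of the listed ones. -/
def pushSymbol {Λ : Type} (k : K) (again : Λ) : List Γ' → TM2.Stmt (Alphabet K) Λ (Option Γ')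
  | [] => .halt
  | s :: l => .branch (fun v => v == some s)
      (.load (fun _ => none) (pushAll k (true :: word (symbolBits s)) (.goto fun _ => again)))
      (pushSymbol k again l)

/-- The machine that first transforms the input string into the representation of the reversed list
of its symbols, then runs a program, and finally replaces the representation of a Boolean by the
Boolean itself. -/
noncomputable def host (c : StackProg (Option K)) :
    Fin 3 ⊕ c.Label → TM2.Stmt (Alphabet (Option K)) (Fin 3 ⊕ c.Label) (Option Γ')
  | .inl 0 => .push (some none) (fun _ => false) (.goto fun _ => .inl 1)
  | .inl 1 => .pop none (fun _ o => o) <| .branch (fun v => v.isNone)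
      (.goto fun _ => .inr c.entry) (pushSymbol none (.inl 1) Finset.univ.toList)
  | .inl 2 => .pop (some none) (fun _ o => o.map Γ'.bit) <| .pop (some none) (fun v _ => v) <|
      .pop (some none) (fun v _ => v) <|
      .push (some none) (fun v => (v.map sectionΓ'Bool).getD false) <| .load (fun _ => none) .halt
  | .inr l => c.compile Sum.inr (.inl 2) l

variable [DecidableEq K]

theorem stepAux_pushAll {Λ : Type} (k : K) (w : List Bool)
    (q : TM2.Stmt (Alphabet K) Λ (Option Γ')) (v : Option Γ') (u : List Γ')
    (s : K → List Bool) :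
    TM2.stepAux (pushAll k w q) v (stackMap u s) =
      TM2.stepAux q v (stackMap u (update s k (w ++ s k))) := by
  induction w generalizing q with
  | nil => simp [pushAll]
  | cons x w ih =>
    rw [pushAll, ih, TM2.stepAux, update_stackMap]
    simp [stackMap]

theorem stepAux_pushSymbol {Λ : Type} (k : K) (again : Λ) (l : List Γ') (x : Γ') (hx : x ∈ l)
    (u : List Γ') (s : K → List Bool) :
    TM2.stepAux (pushSymbol k again l) (some x) (stackMap u s) =
      ⟨some again, none, stackMap u (update s k (true :: (word (symbolBits x) ++ s k)))⟩ := by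
  induction l with
  | nil => simp at hx
  | cons y l ih =>
    by_cases hxy : x = y
    · subst hxy
      simp only [pushSymbol, TM2.stepAux, BEq.rfl, cond_true, stepAux_pushAll, List.cons_append]
    · have h : (some x == some y) = false := by simpa using hxy
      simp only [pushSymbol, TM2.stepAux, h, cond_false]
      exact ih ((List.mem_cons.1 hx).resolve_left hxy)

/-- The word of `x :: l` is the word of `l` preceded by `true` and the word of `x`, so consing is
pushing, and one pass over the input builds the list in reverse. Each symbol takes one step; one
more detects the end. -/
theorem host_load (c : StackProg (Option K)) (w : List Γ') (l : List (Bool × Bool × Bool)) :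
    ReachesIn (TM2.step (host c)) ⟨some (.inl 1), none, stackMap w (single (word l))⟩
      ⟨some (.inr c.entry), none,
        stackMap [] (single (word ((w.map symbolBits).reverse ++ l)))⟩ (w.length + 1) := by
  have hpop (x : List Γ') (t : Option K → List Bool) :
      update (stackMap x t) none x.tail = stackMap x.tail t := by
    funext i
    rcases i with _ | i <;> simp [stackMap]
  induction w generalizing l with
  | nil =>
    apply ReachesIn.single
    simp only [TM2.step, host, TM2.stepAux]
    change some (bif true then _ else _) = _
    have := hpop [] (single (word l))
    rw [List.tail_nil] at this
    simp only [cond_true]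
    exact congrArg (fun S => some (TM2.Cfg.mk (some (Sum.inr c.entry)) none S)) this
  | cons x w ih =>
    rw [List.length_cons, Nat.add_comm]
    refine (ReachesIn.single (b := ⟨some (.inl 1), none,
      stackMap w (single (word (symbolBits x :: l)))⟩) ?_).trans ?_
    · simp only [TM2.step, host, TM2.stepAux]
      change some (bif false then _ else
        TM2.stepAux _ (some x) (update (stackMap (x :: w) _) none w)) = _
      have := hpop (x :: w) (single (word l))
      rw [List.tail_cons] at this
      rw [this, cond_false, stepAux_pushSymbol _ _ _ _ (by simp)]
      congr 3
      funext i
      rcases i with _ | i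
      · simp [single, word, tree_cons, BinTree.code]
      · simp [single]
    · simpa using ih (symbolBits x :: l)

/-- `true` has the word `[true, false, false]` and `false` has `[false]`: the top symbol is the
answer. Three pops empty the stack in both cases, as popping an empty stack is harmless. -/
theorem host_finish (c : StackProg (Option K)) (b : Bool) :
    TM2.step (host c) ⟨some (.inl 2), none, stackMap [] (single (word b))⟩ =
      some ⟨none, none, stackMap [] (single [b])⟩ := by
  simp only [TM2.step, host, TM2.stepAux, update_stackMap]
  cases b
  · congr 3
    funext i
    rcases i with _ | i <;> simp [stackMap, single, word, tree_false, BinTree.code]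
    rfl
  · congr 3
    funext i
    rcases i with _ | i <;> simp [stackMap, single, word, tree_true, BinTree.code]
    rfl

end StackProg

theorem size_map_symbolBits_le (w : List Γ') :
    size (w.map symbolBits).reverse ≤ 12 * w.length + 1 := by
  rw [← List.map_reverse, ← w.length_reverse]
  induction w.reverse with
  | nil => simp [size_nil]
  | cons x l ih =>
    have := size_symbolBits_le x
    rw [List.map_cons, size_cons, List.length_cons]
    omega

/-- By `henc` the loading phase produces exactly the word on which the program for `f` expects to
start, and its size is linear in the length of the string. -/
theorem PolyTime.nonempty_tm2 {α : Type} [TreeRep α] (enc : α → List Γ')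
    (henc : ∀ a, tree a = tree ((enc a).map symbolBits).reverse) {f : α → Bool}
    (hf : PolyTime f) :
    Nonempty (TM2ComputableInPolyTime enc encodingBoolBool.encode f) := by
  obtain ⟨K, _, _, c, q, h⟩ := hf
  let _ := c.labelFintype
  let tm : FinTM2 :=
    { K := Option (Option K)
      k₀ := none
      k₁ := some none
      Γ := Alphabet (Option K)
      Λ := Fin 3 ⊕ c.Label
      main := .inl 0
      σ := Option Γ'
      initialState := none
      Γk₀Fin := inferInstanceAs (Fintype Γ')
      m := host c }
  refine ⟨⟨⟨tm, Equiv.refl Γ', Equiv.refl Bool⟩,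
    -- Besides the program itself: one initial step, the length plus one for loading, and one final
    -- step.
    Polynomial.X + 3 + q.comp (12 * Polynomial.X + 1), fun a => Classical.choice ?_⟩⟩
  have h₁ : TM2.step (host c) ⟨some (.inl 0), none, stackMap (enc a) fun _ => []⟩ =
      some ⟨some (.inl 1), none,
        stackMap (enc a) (single (word ([] : List (Bool × Bool × Bool))))⟩ := by
    simp only [TM2.step, host, TM2.stepAux, update_stackMap]
    congr 3
    funext i
    rcases i with _ | i <;> simp [stackMap, single, word, tree_nil, BinTree.code]
  have h₂ := host_load c (enc a) []
  have h₃ := (h a).1.reachesIn (M := host c) (inj := Sum.inr) (out := .inl 2) (fun _ => rfl) []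
  rw [List.append_nil, ← word_eq_of_tree_eq (henc a)] at h₂
  have h₄ := (((ReachesIn.single h₁).trans h₂).trans h₃).trans
    (ReachesIn.single (host_finish c (f a)))
  have hs : size a ≤ 12 * (enc a).length + 1 :=
    (size_eq_of_tree_eq (henc a)).trans_le (size_map_symbolBits_le _)
  have h₅ := h₄.mono (n := (Polynomial.X + 3 + q.comp (12 * Polynomial.X + 1)).eval
    (enc a).length) (by
      have := polynomial_eval_mono q hs
      simp only [Polynomial.eval_add, Polynomial.eval_X, Polynomial.eval_ofNat,
        Polynomial.eval_comp, Polynomial.eval_mul, Polynomial.eval_one]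
      omega)
  have hin : initList tm (List.map (Equiv.refl Γ').invFun (enc a)) =
      ⟨some (.inl 0), none, stackMap (enc a) fun _ => []⟩ := by
    have : List.map (Equiv.refl Γ').invFun (enc a) = enc a := List.map_id _
    rw [this]
    unfold initList
    congr 1
    funext k
    rcases k with _ | k <;> rfl
  have hout : haltList tm (List.map (Equiv.refl Bool).invFun (encodingBoolBool.encode (f a))) =
      ⟨none, none, stackMap [] (single [f a])⟩ := by
    unfold haltList
    congr 1
    funext k
    rcases k with _ | _ | k <;> rfl
  unfold TM2OutputsInTime
  change Nonempty (StateTransition.EvalsToInTime tm.step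
    (initList tm (List.map (Equiv.refl Γ').invFun (enc a)))
    (some (haltList tm (List.map (Equiv.refl Bool).invFun (encodingBoolBool.encode (f a))))) _)
  rw [hin, hout]
  exact h₅

/-! ### Parsing the input string -/

/-- Processes one more symbol when an input string is parsed from right to left. -/
def parseStep (ls : List (List (List Bool))) (s : Bool × Bool × Bool) : List (List (List Bool)) :=
  if s.1 then
    if s.2.1 then
      if s.2.2 then ls else [] :: ls
    else match ls with
      | [] => []
      | m :: t => ([] :: m) :: t
  else match ls with
    | [] => []
    | m :: t => match m with
      | [] => []
      | w :: m => ((s.2.1 :: w) :: m) :: t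

theorem polyTime_parseStep :
    PolyTime fun x : List (List (List Bool)) × (Bool × Bool × Bool) => parseStep x.1 x.2 := by
  have h₁ : PolyTime fun x : List (List (List Bool)) × (Bool × Bool × Bool) => x.2.1 :=
    .comp .fst .snd
  have h₂ : PolyTime fun x : List (List (List Bool)) × (Bool × Bool × Bool) => x.2.2.1 :=
    .comp .fst (.comp .snd .snd)
  have h₃ : PolyTime fun x : List (List (List Bool)) × (Bool × Bool × Bool) => x.2.2.2 :=
    .comp .snd (.comp .snd .snd)
  have h₄ := PolyTime.fst.listCases (α := List (List (List Bool)) × (Bool × Bool × Bool))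
    (f := fun _ m t => ([] :: m) :: t) (.const [])
    (((PolyTime.const []).cons (.comp .fst .snd)).cons (.comp .snd .snd))
  have h₅ := PolyTime.fst.listCases (α := List (List (List Bool)) × (Bool × Bool × Bool))
    (f := fun x m t => match m with
      | [] => []
      | w :: m => ((x.2.2.1 :: w) :: m) :: t) (.const [])
    (((PolyTime.comp .fst .snd).listCases
      (f := fun (y : (List (List (List Bool)) × (Bool × Bool × Bool)) ×
        List (List Bool) × List (List (List Bool))) w m => ((y.1.2.2.1 :: w) :: m) :: y.2.2)
      (.const []) ((((h₂.comp (.comp .fst .fst)).cons (.comp .fst .snd)).cons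
        (.comp .snd .snd)).cons (.comp .snd (.comp .snd .fst)))).congr
      fun y => by rcases y with ⟨_, _ | ⟨_, _⟩, _⟩ <;> rfl)
  refine (h₁.cond (h₂.cond (h₃.cond .fst ((PolyTime.const []).cons .fst)) h₄) h₅).congr fun x => ?_
  rcases x with ⟨_ | ⟨_ | ⟨_, _⟩, _⟩, _, _, _⟩ <;> rfl

theorem size_parseStep_le (ls : List (List (List Bool))) (s : Bool × Bool × Bool) :
    size (parseStep ls s) ≤ size ls + 4 := by
  unfold parseStep
  split
  · split
    · split
      · omega
      · rw [size_cons, size_nil]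
        omega
    · split
      · omega
      · simp only [size_cons, size_nil]
        omega
  · split
    · omega
    · split
      · rw [size_nil]
        omega
      · have := size_bool_le s.2.1
        simp only [size_cons]
        omega

/-- The lists of numbers in a string. -/
def parse (ls : List (List (List Bool))) (w : List Γ') : List (List (List Bool)) :=
  w.foldr (fun s ls => parseStep ls (symbolBits s)) ls

theorem parse_encodeNumber (n : ℕ) (m : List (List Bool)) (t : List (List (List Bool))) :
    parse (m :: t) (ACuDCInput.encodeNumber n) = (encodeNat n :: m) :: t := by
  have h : ∀ l : List Bool, parse (([] :: m) :: t) (l.map Γ'.bit) = (l :: m) :: t := by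
    intro l
    induction l with
    | nil => rfl
    | cons b l ih => exact congrArg (fun ls => parseStep ls (false, b, false)) ih
  rw [parse, ACuDCInput.encodeNumber, List.foldr_append]
  exact h _

theorem parse_flatMap_encodeNumber (l : List ℕ) (m : List (List Bool))
    (t : List (List (List Bool))) :
    parse (m :: t) (l.flatMap ACuDCInput.encodeNumber) = (l.map encodeNat ++ m) :: t := by
  induction l with
  | nil => rfl
  | cons n l ih =>
    rw [parse] at ih ⊢
    rw [List.flatMap_cons, List.foldr_append, ih]
    exact parse_encodeNumber _ _ _

theorem parse_encodeNumbers (l : List ℕ) (t : List (List (List Bool))) :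
    parse t (ACuDCInput.encodeNumbers l) = l.map encodeNat :: t := by
  have h := parse_flatMap_encodeNumber l [] t
  rw [List.append_nil] at h
  rw [parse, ACuDCInput.encodeNumbers, List.foldr_cons, List.foldr_append]
  exact h

/-- Read from the right, a `ket` opens a new list and a `bra` has no effect. Hence the unbracketed
numbers `p` and `kDC` land in front of the list `C`. -/
theorem parse_encodeString (I : ACuDCInput) :
    parse [] I.encodeString =
      (((I.p :: I.kDC :: I.C) :: I.A :: I.V).map fun l => l.map encodeNat) := by
  have h : ∀ V : List (List ℕ), parse [] (V.flatMap ACuDCInput.encodeNumbers) =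
      V.map fun l => l.map encodeNat := by
    intro V
    induction V with
    | nil => rfl
    | cons l V ih =>
      rw [parse] at ih ⊢
      rw [List.flatMap_cons, List.foldr_append, ih]
      exact parse_encodeNumbers _ _
  have h₁ := h I.V
  have h₂ := parse_encodeNumbers I.A (I.V.map fun l => l.map encodeNat)
  have h₃ := parse_encodeNumbers I.C (I.A.map encodeNat :: I.V.map fun l => l.map encodeNat)
  have h₄ := parse_encodeNumber I.kDC (I.C.map encodeNat)
    (I.A.map encodeNat :: I.V.map fun l => l.map encodeNat)
  have h₅ := parse_encodeNumber I.p (encodeNat I.kDC :: I.C.map encodeNat)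
    (I.A.map encodeNat :: I.V.map fun l => l.map encodeNat)
  rw [parse] at h₁ h₂ h₃ h₄ h₅ ⊢
  rw [ACuDCInput.encodeString, List.foldr_append, List.foldr_append, List.foldr_append,
    List.foldr_append, h₁, h₂, h₃, h₄, h₅]
  rfl

namespace ACuDCInput

/-- This is literally what the machine's loading phase leaves, and the reversal makes parsing from
right to left a left fold. -/
instance : TreeRep ACuDCInput := ⟨fun I => tree (I.encodeString.map symbolBits).reverse⟩

/-- The parser returns lists of bit lists. These have the same trees as the lists of numbers they
encode, so no conversion is needed. -/
theorem polyTime_lists :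
    PolyTime fun I : ACuDCInput => (I.p :: I.kDC :: I.C) :: I.A :: I.V := by
  have h₁ : PolyTime fun l : List (Bool × Bool × Bool) => l.foldl parseStep [] :=
    PolyTime.id.foldl (f := fun _ => parseStep) (.const []) (polyTime_parseStep.comp .snd) 4
      fun _ ls s => by simpa using size_parseStep_le ls s
  have h₂ : ∀ l : List ℕ, tree (l.map encodeNat) = tree l := by
    intro l
    induction l with
    | nil => rfl
    | cons n l ih => rw [List.map_cons, tree_cons, tree_cons, ih]; rfl
  have h₃ : ∀ L : List (List ℕ), tree (L.map fun l => l.map encodeNat) = tree L := by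
    intro L
    induction L with
    | nil => rfl
    | cons l L ih => rw [List.map_cons, tree_cons, tree_cons, ih, h₂]
  refine h₁.of_tree_eq (fun I => (I.encodeString.map symbolBits).reverse) (fun _ => rfl)
    fun I => ?_
  rw [← h₃, ← parse_encodeString, List.foldl_reverse, List.foldr_map, parse]

theorem polyTime_p : PolyTime fun I : ACuDCInput => I.p :=
  ((polyTime_lists.headD []).headD 0).congr fun _ => rfl

theorem polyTime_kDC : PolyTime fun I : ACuDCInput => I.kDC :=
  ((polyTime_lists.headD []).tail.headD 0).congr fun _ => rfl

theorem polyTime_C : PolyTime fun I : ACuDCInput => I.C :=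
  (polyTime_lists.headD []).tail.tail.congr fun _ => rfl

theorem polyTime_A : PolyTime fun I : ACuDCInput => I.A :=
  (polyTime_lists.tail.headD []).congr fun _ => rfl

theorem polyTime_V : PolyTime fun I : ACuDCInput => I.V :=
  polyTime_lists.tail.tail.congr fun _ => rfl

end ACuDCInput

/-! # The control problem for maximin -/

section Elections

/-- A discarded element differs from both `a` and `b`, so it shifts both positions by one. -/
theorem idxOf_filter_lt_iff {q : ℕ → Bool} {a b : ℕ} (ha : q a) (hb : q b) (l : List ℕ) :
    (l.filter q).idxOf a < (l.filter q).idxOf b ↔ l.idxOf a < l.idxOf b := by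
  induction l with
  | nil => simp
  | cons x l ih =>
    by_cases hx : q x
    · simp only [List.filter_cons, hx, if_true, List.idxOf_cons]
      cases x == a <;> cases x == b <;> simp [ih]
    · have hxa : x ≠ a := by rintro rfl; exact hx ha
      have hxb : x ≠ b := by rintro rfl; exact hx hb
      simp [hx, hxa, hxb, ih]

theorem Election.prefCount_restrict (E : Election) {X : Finset ℕ} {a b : ℕ} (ha : a ∈ X)
    (hb : b ∈ X) : (E.restrict X).prefCount a b = E.prefCount a b := by
  simp only [Election.prefCount, Election.restrict, List.countP_map]
  congr 1
  funext v
  simp only [Function.comp_apply, decide_eq_decide]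
  exact idxOf_filter_lt_iff (by simpa using ha) (by simpa using hb) v

theorem maximin_isUniqueWinner_iff_score {E : Election} {p : ℕ} (hp : p ∈ E.cands) :
    maximin.IsUniqueWinner E p ↔
      ∀ d ∈ E.cands, d ≠ p → E.maximinScore d < E.maximinScore p := by
  unfold ElectionSystem.IsUniqueWinner maximin
  simp only [Finset.eq_singleton_iff_unique_mem, Finset.mem_filter, and_imp]
  constructor
  · rintro ⟨⟨-, hmax⟩, huniq⟩ d hd hdp
    refine lt_of_le_of_ne (hmax d hd) fun heq => hdp (huniq d hd fun e he => ?_)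
    rw [heq]
    exact hmax e he
  · intro h
    refine ⟨⟨hp, fun d hd => ?_⟩, fun d hd hmax => ?_⟩
    · by_cases hdp : d = p
      · rw [hdp]
      · exact (h d hd hdp).le
    · by_contra hdp
      exact absurd (hmax p hp) (h d hd hdp).not_ge

/-- The score of `p` is attained against some `c` and serves as threshold; a rival scores less
exactly when some opponent holds it below that threshold. -/
theorem maximin_isUniqueWinner_iff {E : Election} {p : ℕ} (hp : p ∈ E.cands) :
    maximin.IsUniqueWinner E p ↔ ∃ c ∈ E.cands, ∀ d ∈ E.cands, d ≠ p →
      E.prefCount p c ≤ E.prefCount p d ∧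
        ∃ e ∈ E.cands, e ≠ d ∧ E.prefCount d e < E.prefCount p c := by
  rw [maximin_isUniqueWinner_iff_score hp]
  constructor
  · intro h
    rcases (E.cands.erase p).eq_empty_or_nonempty with hE | hE
    -- Here `p` is the only candidate, so nothing is required of the witness.
    · refine ⟨p, hp, fun d hd hdp => ?_⟩
      have : d ∈ E.cands.erase p := Finset.mem_erase.2 ⟨hdp, hd⟩
      rw [hE] at this
      simp at this
    · obtain ⟨c, hc, hpc⟩ := Finset.exists_mem_eq_inf (E.cands.erase p) hE
        fun d => (E.prefCount p d : ℕ∞)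
      refine ⟨c, Finset.mem_of_mem_erase hc, fun d hd hdp => ⟨?_, ?_⟩⟩
      · have : (E.cands.erase p).inf (fun d => (E.prefCount p d : ℕ∞)) ≤ E.prefCount p d :=
          Finset.inf_le (Finset.mem_erase.2 ⟨hdp, hd⟩)
        rw [hpc] at this
        exact_mod_cast this
      · have := h d hd hdp
        unfold Election.maximinScore at this
        rw [hpc, Finset.inf_lt_iff] at this
        obtain ⟨e, he, hlt⟩ := this
        rw [Finset.mem_erase] at he
        exact ⟨e, he.2, he.1, by exact_mod_cast hlt⟩
  · rintro ⟨c, -, h⟩ d hd hdp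
    obtain ⟨-, e, he, hed, hlt⟩ := h d hd hdp
    calc E.maximinScore d ≤ E.prefCount d e := Finset.inf_le (Finset.mem_erase.2 ⟨hed, he⟩)
      _ < E.prefCount p c := by exact_mod_cast hlt
      _ ≤ E.maximinScore p := Finset.le_inf fun f hf => by
        rw [Finset.mem_erase] at hf
        exact_mod_cast (h f hf.2 hf.1).1

end Elections

namespace ACuDCInput

variable (I : ACuDCInput)

/-- Within the set `R` of candidates, `p` beats or ties the threshold `k` against all others, and
all others miss this threshold. -/
def Attains (k : ℕ) (R : Finset ℕ) : Prop :=
  ∀ d ∈ R, d ≠ I.p → k ≤ I.fullElection.prefCount I.p d ∧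
    ∃ e ∈ R, e ≠ d ∧ I.fullElection.prefCount d e < k

theorem isUniqueWinner_restrict_iff {R : Finset ℕ} (hR : R ⊆ (I.C ++ I.A).toFinset)
    (hp : I.p ∈ R) : maximin.IsUniqueWinner (I.fullElection.restrict R) I.p ↔
      ∃ c ∈ R, I.Attains (I.fullElection.prefCount I.p c) R := by
  have hc : (I.fullElection.restrict R).cands = R := Finset.inter_eq_right.2 hR
  rw [maximin_isUniqueWinner_iff (by rwa [hc]), hc]
  refine exists_congr fun c => and_congr_right fun hc => forall₂_congr fun d hd =>
    imp_congr_right fun _ => ?_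
  rw [Election.prefCount_restrict _ hp hc, Election.prefCount_restrict _ hp hd]
  refine and_congr_right fun _ => exists_congr fun e => and_congr_right fun he => ?_
  rw [Election.prefCount_restrict _ hd he]

/-- The candidate `c` that fixes the threshold need not belong to `R`: the score of `p` within `R`
is still at least the threshold and all rivals stay below it. Thus `c` can be chosen before `R`. -/
theorem constructiveACuDC_iff : maximin.ConstructiveACuDC I ↔
    ∃ c ∈ (I.C ++ I.A).toFinset, ∃ R ⊆ (I.C ++ I.A).toFinset, I.p ∈ R ∧
      I.Attains (I.fullElection.prefCount I.p c) R ∧ (I.C.toFinset \ R).card ≤ I.kDC := by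
  constructor
  · rintro ⟨A', C', hA, hC, hp, hcard, hwin⟩
    have hR : (I.C.toFinset \ C') ∪ A' ⊆ (I.C ++ I.A).toFinset := by
      rw [List.toFinset_append]
      exact Finset.union_subset_union Finset.sdiff_subset hA
    have hpR : I.p ∈ (I.C.toFinset \ C') ∪ A' := by simp [I.p_mem, hp]
    obtain ⟨c, hc, h⟩ := (I.isUniqueWinner_restrict_iff hR hpR).1 hwin
    refine ⟨c, hR hc, _, hR, hpR, h, (Finset.card_le_card fun x hx => ?_).trans hcard⟩
    simp only [Finset.mem_sdiff, Finset.mem_union, not_or, not_and_or, not_not] at hx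
    tauto
  · rintro ⟨c, hc, R, hR, hpR, h, hcard⟩
    have hp := I.p_mem
    refine ⟨R ∩ I.A.toFinset, I.C.toFinset \ R, Finset.inter_subset_right, Finset.sdiff_subset,
      by simp [hpR], hcard, ?_⟩
    have hRR : (I.C.toFinset \ (I.C.toFinset \ R)) ∪ (R ∩ I.A.toFinset) = R := by
      ext x
      have := @hR x
      simp only [List.toFinset_append, Finset.mem_union] at this
      simp only [Finset.mem_union, Finset.mem_sdiff, Finset.mem_inter]
      tauto
    rw [controlledElection, hRR]
    have hE : (I.fullElection.restrict R).cands = R := Finset.inter_eq_right.2 hR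
    rw [maximin_isUniqueWinner_iff_score (by rwa [hE]), hE]
    intro d hd hdp
    obtain ⟨-, e, he, hed, hlt⟩ := h d hd hdp
    calc (I.fullElection.restrict R).maximinScore d ≤ (I.fullElection.restrict R).prefCount d e :=
          Finset.inf_le (Finset.mem_erase.2 ⟨hed, by rwa [hE]⟩)
      _ < I.fullElection.prefCount I.p c := by
        rw [Election.prefCount_restrict _ hd he]
        exact_mod_cast hlt
      _ ≤ (I.fullElection.restrict R).maximinScore I.p := Finset.le_inf fun f hf => by
        rw [Finset.mem_erase, hE] at hf
        rw [Election.prefCount_restrict _ hpR hf.2]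
        exact_mod_cast (h f hf.2 hf.1).1

/-! ### The algorithm -/

/-- The voters who prefer `d` to `e`. -/
def supporters (d e : ℕ) : List (List ℕ) :=
  I.V.filter fun v => decide (v.idxOf d < v.idxOf e)

/-- All candidates. -/
def candidates : List ℕ := I.A.reverse ++ I.C

/-- The preferred candidate and the candidates against which it attains the threshold, which is the
length of the list `t`. -/
def base (t : List (List ℕ)) : List ℕ :=
  I.candidates.filter fun d =>
    decide (d = I.p) || !decide ((I.supporters I.p d).length < t.length)

/-- Removes the candidates other than `p` that attain the threshold against all others. -/
def prune (t : List (List ℕ)) (R : List ℕ) : List ℕ :=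
  R.filter fun d => decide (d = I.p) || R.any fun e =>
    !decide (e = d) && decide ((I.supporters d e).length < t.length)

/-- The largest set of candidates within which `p` attains the threshold and all others miss it. -/
def remaining (t : List (List ℕ)) : List ℕ :=
  I.candidates.foldl (fun R _ => I.prune t R) (I.base t)

/-- The candidates that have to be deleted. -/
def deleted (t : List (List ℕ)) : List ℕ :=
  I.C.filter fun c => !(I.remaining t).any fun d => decide (d = c)

/-- The answer to the control problem. -/
def answer : Bool :=
  I.candidates.any fun c => decide ((I.deleted (I.supporters I.p c)).length ≤ I.kDC)

/-! ### Correctness -/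

theorem length_supporters (d e : ℕ) :
    (I.supporters d e).length = I.fullElection.prefCount d e := by
  rw [Election.prefCount, List.countP_eq_length_filter]
  rfl

theorem mem_candidates {c : ℕ} : c ∈ I.candidates ↔ c ∈ (I.C ++ I.A).toFinset := by
  simp [candidates, or_comm]

/-- Pruning takes a sublist, so a round that changes the list shortens it; this happens at most `n`
times. -/
theorem iterate_prune_fixed (t : List (List ℕ)) (n : ℕ) (R : List ℕ) (hR : R.length ≤ n) :
    I.prune t ((I.prune t)^[n] R) = (I.prune t)^[n] R := by
  induction n generalizing R with
  | zero =>
    obtain rfl := List.length_eq_zero_iff.1 (Nat.le_zero.1 hR)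
    rfl
  | succ n ih =>
    by_cases h : I.prune t R = R
    · rw [iterate_fixed h, h]
    · rw [iterate_succ_apply]
      refine ih _ (Nat.le_of_lt_succ (lt_of_lt_of_le ?_ hR))
      refine lt_of_le_of_ne (List.length_filter_le _ _) fun hlen => h ?_
      exact List.filter_sublist.eq_of_length hlen

theorem remaining_eq (t : List (List ℕ)) :
    I.remaining t = (I.prune t)^[I.candidates.length] (I.base t) :=
  List.foldl_const _ _ _

theorem prune_remaining (t : List (List ℕ)) : I.prune t (I.remaining t) = I.remaining t := by
  rw [remaining_eq]
  exact I.iterate_prune_fixed t _ _ (List.length_filter_le _ _)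

theorem remaining_subset_base (t : List (List ℕ)) : I.remaining t ⊆ I.base t := by
  rw [remaining_eq]
  generalize I.candidates.length = n
  induction n with
  | zero => exact List.Subset.refl _
  | succ n ih =>
    rw [iterate_succ_apply']
    exact List.Subset.trans List.filter_sublist.subset ih

/-- A fixed point of pruning consists of `p` and candidates that miss the threshold against some
survivor; the condition on `p` is inherited from `base`. -/
theorem attains_remaining (t : List (List ℕ)) :
    I.Attains t.length (I.remaining t).toFinset := by
  intro d hd hdp
  rw [List.mem_toFinset] at hd
  have h₁ := I.remaining_subset_base t hd
  rw [← prune_remaining] at hd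
  simp only [base, prune, List.mem_filter, Bool.or_eq_true, decide_eq_true_eq, hdp, false_or,
    Bool.not_eq_true', decide_eq_false_iff_not, not_lt, List.any_eq_true, Bool.and_eq_true,
    length_supporters] at h₁ hd
  obtain ⟨-, e, he, hed, hlt⟩ := hd
  exact ⟨h₁.2, e, List.mem_toFinset.2 he, hed, hlt⟩

/-- As long as all of `R` survives, so do the opponents in `R` that keep its members below the
threshold; hence no round removes a member of `R`. -/
theorem subset_remaining {t : List (List ℕ)} {R : Finset ℕ} (hR : R ⊆ (I.C ++ I.A).toFinset)
    (h : I.Attains t.length R) {d : ℕ} (hd : d ∈ R) : d ∈ I.remaining t := by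
  rw [remaining_eq]
  generalize I.candidates.length = n
  induction n generalizing d with
  | zero =>
    simp only [iterate_zero_apply, base, List.mem_filter, mem_candidates, Bool.or_eq_true,
      decide_eq_true_eq, Bool.not_eq_true', decide_eq_false_iff_not, not_lt, length_supporters]
    exact ⟨hR hd, or_iff_not_imp_left.2 fun hdp => (h d hd hdp).1⟩
  | succ n ih =>
    rw [iterate_succ_apply']
    simp only [prune, List.mem_filter, Bool.or_eq_true, decide_eq_true_eq, Bool.not_eq_true',
      decide_eq_false_iff_not, List.any_eq_true, Bool.and_eq_true, length_supporters]
    refine ⟨ih hd, or_iff_not_imp_left.2 fun hdp => ?_⟩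
    obtain ⟨-, e, he, hed, hlt⟩ := h d hd hdp
    exact ⟨e, ih he, hed, hlt⟩

theorem length_deleted (t : List (List ℕ)) :
    (I.deleted t).length = (I.C.toFinset \ (I.remaining t).toFinset).card := by
  rw [deleted, ← List.toFinset_card_of_nodup ((List.nodup_append.1 I.nodup).1.filter _)]
  congr 1
  ext c
  simp only [List.mem_toFinset, List.mem_filter, Bool.not_eq_true', List.any_eq_false,
    decide_eq_true_eq, Finset.mem_sdiff]
  exact and_congr_right fun _ => ⟨fun h hc => h c hc rfl, fun h d hd hdc => h (hdc ▸ hd)⟩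

theorem answer_iff : I.answer = true ↔ maximin.ConstructiveACuDC I := by
  rw [constructiveACuDC_iff]
  simp only [answer, List.any_eq_true, mem_candidates, decide_eq_true_eq, length_deleted,
    ← length_supporters]
  refine exists_congr fun c => and_congr_right fun hc => ⟨fun h => ?_, ?_⟩
  · have hsub : I.remaining (I.supporters I.p c) ⊆ I.candidates :=
      List.Subset.trans (I.remaining_subset_base _) List.filter_sublist.subset
    refine ⟨_, fun d hd => I.mem_candidates.1 (hsub (List.mem_toFinset.1 hd)), ?_,
      I.attains_remaining _, h⟩
    -- The set `{p}` attains every threshold vacuously, so `p` is never discarded.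
    refine List.mem_toFinset.2 (I.subset_remaining (R := {I.p}) ?_ ?_ (Finset.mem_singleton_self _))
    · simp [I.p_mem]
    · intro d hd hdp
      exact absurd (Finset.mem_singleton.1 hd) hdp
  · rintro ⟨R, hR, -, h, hcard⟩
    refine (Finset.card_le_card (Finset.sdiff_subset_sdiff le_rfl fun d hd => ?_)).trans hcard
    exact List.mem_toFinset.2 (I.subset_remaining hR h hd)

end ACuDCInput

/-! ### Running time -/

namespace PolyTime

variable {α β : Type} [TreeRep α] [TreeRep β]

theorem _root_.TreeRep.size_filter_le (p : β → Bool) (l : List β) : size (l.filter p) ≤ size l := by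
  induction l with
  | nil => exact le_rfl
  | cons b l ih =>
    rw [List.filter_cons]
    split
    · simp only [size_cons]
      omega
    · rw [size_cons]
      omega

/-- One step of the search for the first of two names in a list. -/
def findStep (d e : ℕ) (s : Bool × Bool) (x : ℕ) : Bool × Bool :=
  if s.1 then s else if decide (x = e) then (true, false) else
    if decide (x = d) then (true, true) else s

/-- The first occurrence of either name freezes the state. Testing `e` before `d` gives `false` when
`d = e`, as the strict inequality demands; a missing name has the length of the list as its index.
-/
theorem foldl_findStep (d e : ℕ) (v : List ℕ) :
    (v.foldl (findStep d e) (false, false)).2 = decide (v.idxOf d < v.idxOf e) := by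
  have h : ∀ (v : List ℕ) (b : Bool), v.foldl (findStep d e) (true, b) = (true, b) := by
    intro v b
    induction v with
    | nil => rfl
    | cons x v ih => exact ih
  induction v with
  | nil => simp
  | cons x v ih =>
    rw [List.foldl_cons, List.idxOf_cons, List.idxOf_cons]
    by_cases hxe : x = e
    · simp [findStep, hxe, h]
    · have hxe' : (x == e) = false := by simpa using hxe
      by_cases hxd : x = d
      · have hxd' : (x == d) = true := by simpa using hxd
        have hs : findStep d e (false, false) x = (true, true) := by
          simp only [findStep, hxd]
          simp [hxd ▸ hxe]
        simp [hxe', hxd', hs, h]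
      · have hxd' : (x == d) = false := by simpa using hxd
        simp only [hxe', hxd', findStep, hxe, hxd]
        simpa using ih

theorem idxOf_lt {d e : α → ℕ} {v : α → List ℕ} (hd : PolyTime d) (he : PolyTime e)
    (hv : PolyTime v) : PolyTime fun a => decide ((v a).idxOf (d a) < (v a).idxOf (e a)) := by
  refine (snd.comp (hv.foldl (f := fun a => findStep (d a) (e a)) (const (false, false))
    ((fst.comp (fst.comp snd)).cond (fst.comp snd)
      (((snd.comp snd).nat_eq (he.comp fst)).cond (const (true, false))
        (((snd.comp snd).nat_eq (hd.comp fst)).cond (const (true, true)) (fst.comp snd)))) 7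
    fun a s x => ?_)).congr fun a => foldl_findStep _ _ _
  obtain ⟨b, c⟩ := findStep (d a) (e a) s x
  have := size_bool_le b
  have := size_bool_le c
  rw [size_pair, Polynomial.eval_ofNat]
  omega

end PolyTime

namespace ACuDCInput

variable {α : Type} [TreeRep α]

theorem polyTime_supporters {I : α → ACuDCInput} {d e : α → ℕ} (hI : PolyTime I)
    (hd : PolyTime d) (he : PolyTime e) : PolyTime fun a => (I a).supporters (d a) (e a) :=
  have h : PolyTime fun x : α × List ℕ => decide (x.2.idxOf (d x.1) < x.2.idxOf (e x.1)) :=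
    (hd.comp .fst).idxOf_lt (he.comp .fst) .snd
  ((polyTime_V.comp hI).filter (p := fun a v => decide (v.idxOf (d a) < v.idxOf (e a))) h).congr
    fun _ => rfl

theorem polyTime_candidates : PolyTime fun I : ACuDCInput => I.candidates :=
  polyTime_A.reverseAux polyTime_C

theorem polyTime_base : PolyTime fun x : ACuDCInput × List (List ℕ) => x.1.base x.2 := by
  refine (polyTime_candidates.comp .fst).filter
    (p := fun (x : ACuDCInput × List (List ℕ)) d =>
      decide (d = x.1.p) || !decide ((x.1.supporters x.1.p d).length < x.2.length)) ?_
  have hI : PolyTime fun y : (ACuDCInput × List (List ℕ)) × ℕ => y.1.1 := .comp .fst .fst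
  exact (PolyTime.snd.nat_eq (polyTime_p.comp hI)).or
    ((polyTime_supporters hI (polyTime_p.comp hI) .snd).length_lt (.comp .snd .fst)).not

theorem polyTime_prune :
    PolyTime fun x : (ACuDCInput × List (List ℕ)) × List ℕ => x.1.1.prune x.1.2 x.2 := by
  refine PolyTime.snd.filter
    (p := fun (x : (ACuDCInput × List (List ℕ)) × List ℕ) d => decide (d = x.1.1.p) ||
      x.2.any fun e => !decide (e = d) &&
        decide ((x.1.1.supporters d e).length < x.1.2.length)) ?_
  have hI : PolyTime fun y : ((ACuDCInput × List (List ℕ)) × List ℕ) × ℕ => y.1.1.1 :=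
    .comp .fst (.comp .fst .fst)
  have hI' : PolyTime fun z : (((ACuDCInput × List (List ℕ)) × List ℕ) × ℕ) × ℕ => z.1.1.1.1 :=
    hI.comp .fst
  refine (PolyTime.snd.nat_eq (polyTime_p.comp hI)).or
    ((PolyTime.comp .snd .fst).any
      (p := fun (y : ((ACuDCInput × List (List ℕ)) × List ℕ) × ℕ) e => !decide (e = y.2) &&
        decide ((y.1.1.1.supporters y.2 e).length < y.1.1.2.length)) ?_)
  exact (PolyTime.snd.nat_eq (.comp .snd .fst)).not.and
    ((polyTime_supporters hI' (.comp .snd .fst) .snd).length_lt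
      (.comp .snd (.comp .fst (.comp .fst .fst))))

/-- Pruning never enlarges the list, so the growth bound of the fold is `0`. -/
theorem polyTime_remaining : PolyTime fun x : ACuDCInput × List (List ℕ) => x.1.remaining x.2 :=
  have h : PolyTime fun y : (ACuDCInput × List (List ℕ)) × List ℕ × ℕ =>
      y.1.1.prune y.1.2 y.2.1 :=
    polyTime_prune.comp (PolyTime.fst.pair (.comp .fst .snd))
  (polyTime_candidates.comp .fst).foldl
    (f := fun (x : ACuDCInput × List (List ℕ)) R (_ : ℕ) => x.1.prune x.2 R) polyTime_base h 0
    fun _ _ _ => (size_filter_le _ _).trans (Nat.le_add_right _ _)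

theorem polyTime_deleted : PolyTime fun x : ACuDCInput × List (List ℕ) => x.1.deleted x.2 := by
  refine (polyTime_C.comp .fst).filter
    (p := fun (x : ACuDCInput × List (List ℕ)) c =>
      !(x.1.remaining x.2).any fun d => decide (d = c)) ?_
  exact ((polyTime_remaining.comp .fst).any
    (p := fun (y : (ACuDCInput × List (List ℕ)) × ℕ) d => decide (d = y.2))
    (PolyTime.snd.nat_eq (.comp .snd .fst))).not

theorem polyTime_answer : PolyTime answer := by
  refine polyTime_candidates.any
    (p := fun (I : ACuDCInput) c => decide ((I.deleted (I.supporters I.p c)).length ≤ I.kDC)) ?_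
  exact (polyTime_deleted.comp (PolyTime.fst.pair
    (polyTime_supporters .fst (polyTime_p.comp .fst) .snd))).length_le_nat
      (polyTime_kDC.comp .fst)

end ACuDCInput

/-! ### Vulnerability -/

/-- The only voter ranks `p = 0` last, so `p` scores 0 against candidate 1 and cannot win alone.
Deleting 1 and adding nobody leaves `p` as sole candidate. -/
theorem maximin_susceptible : maximin.SusceptibleConstructiveACuDC := by
  let I : ACuDCInput :=
    { C := [0, 1]
      A := [2]
      V := [[1, 2, 0]]
      p := 0
      kDC := 1
      nodup := by decide
      isPref := by
        intro v hv
        rw [List.mem_singleton.1 hv]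
        exact ⟨by decide, by decide⟩
      p_mem := by decide }
  refine ⟨I, fun h => ?_, ?_⟩
  · obtain ⟨c, hc, h⟩ := (I.isUniqueWinner_restrict_iff (by decide) (by decide)).1 h
    obtain ⟨-, e, -, -, hlt⟩ := h 1 (by decide) (by decide)
    have h₀ : ∀ c ∈ I.C.toFinset, I.fullElection.prefCount I.p c = 0 := by decide
    rw [h₀ c hc] at hlt
    exact absurd hlt (Nat.not_lt_zero _)
  -- By correctness of the algorithm it suffices to evaluate it on this instance.
  · rw [← I.answer_iff]
    decide

theorem mainTheorem2 : maximin.VulnerableConstructiveACuDC :=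
  ⟨maximin_susceptible, ACuDCInput.answer, ACuDCInput.answer_iff,
    ACuDCInput.polyTime_answer.nonempty_tm2 _ fun _ => rfl⟩
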